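/- **Setting.** A $U(d)$-connection graph $(G,\sigma)$ consists of a locally finite weighted graph $G=(V,w,\mu)$ (edge weights $w_{xy}=w_{yx}\ge 0$ with $w_{xx}=0$, vertex measure $\mu_x>0$, and $x\sim y$ iff $w_{xy}\neq 0$) and unitary matrices $\sigma_{xy}\in U(d)$ for all $x\sim y$ with $\sigma_{xy}=\sigma_{yx}^{-1}$. Its signature group $\Sigma$ is the subgroup of $U(d)$ generated by all $\sigma_{xy}$, $x\sim y$. Put $p_{xy}=w_{xy}/\mu_x$, $\Delta h(x)=\sum_{y\sim x}p_{xy}(h(y)-h(x))$ for $h:V\to\mathbb C$, and, for $f,g:V\to\mathbb C^d$, $$\Delta^\sigma f(x)=\sum_{y\sim x}p_{xy}(\sigma_{xy}f(y)-f(x)),$$ $$2\Gamma^\sigma(f,g)=\Delta(f^\top\overline g)-f^\top\overline{\Delta^\sigma g}-(\Delta^\sigma f)^\top\overline g,$$ $$2\Gamma_2^\sigma(f,g)=\Delta(\Gamma^\sigma(f,g))-\Gamma^\sigma(f,\Delta^\sigma g)-\Gamma^\sigma(\Delta^\sigma f,g).$$ Let $S_r(x)$ be the sphere of radius $r$ around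 $x$ in the graph distance, $S_1(x)=\{y_1,\dots,y_m\}$, $B_1(x)=\{x\}\cup S_1(x)$. Let $\Gamma_2^\sigma(x)$ be the Hermitian matrix with $f^\top\Gamma_2^\sigma(x)\overline g=\Gamma_2^\sigma(f,g)(x)$, and let $$Q(x)=\Gamma_2^\sigma(x)_{B_1,B_1}-\Gamma_2^\sigma(x)_{B_1,S_2}\big(\Gamma_2^\sigma(x)_{S_2,S_2}\big)^{-1}\Gamma_2^\sigma(x)_{S_2,B_1}.$$ Let $B_0$ be the $(m+1)d\times(m+1)d$ matrix with first block row $(I_d,\overline{\sigma_{xy_1}},\dots,\overline{\sigma_{xy_m}})$ and lower block rows $\big(\mathbf 0,\mathrm{diag}(p_{xy_1}^{-1/2}I_d,\dots,p_{xy_m}^{-1/2}I_d)\big)$. Write $$2B_0Q(x)\overline{B_0}^\top=\begin{pmatrix}a&\omega^\top\\ \overline\omega&C\end{pmatrix}$$ with $a$ of size $d\times d$. Let $\mathbf v_0(x)$ be the $md\times d$ matrix with blocks $\sqrt{p_{xy_i}}\,\sigma_{xy_i}^\top$; equivalently, $\mathbf v_0(x)$ is the lower part of $B_0\Delta^\sigma(x)$,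 where $\Delta^\sigma(x)^\top=\big(-\sum_i p_{xy_i}I_d,\ p_{xy_1}\sigma_{xy_1},\dots,p_{xy_m}\sigma_{xy_m}\big)$. With ${}^\dagger$ the Moore–Penrose pseudoinverse, the curvature matrices at $x$ are $$A_\infty(x)=C-\overline\omega a^\dagger\omega^\top,\qquad A_N(x)=A_\infty(x)-\tfrac2N\mathbf v_0(x)\overline{\mathbf v_0(x)}^\top,\quad N\in(0,\infty],\ \tfrac2\infty=0.$$ For $\alpha,\beta>0$, the Cartesian product $(G,\sigma)\times_{\alpha,\beta}(G',\sigma')$ is the connection graph on $V\times V'$ with $\mu_{(x,x')}=\mu_x\mu'_{x'}$, $w_{(x,x')(y,x')}=\alpha w_{xy}\mu'_{x'}$, $w_{(x,x')(x,y')}=\beta w'_{x'y'}\mu_x$ (all other weights $0$), $\sigma^\times_{(x,x')(y,x')}=\sigma_{xy}$ and $\sigma^\times_{(x,x')(x,y')}=\sigma'_{x'y'}$. Its curvature matrices at $(x,x')$ are denoted $A_N(x,x')$, with $S_1(x,x')$ ordered so that the vertices $(y_i,x')$, $y_i\in S_1(x)$, come first, followed by the vertices $(x,y'_j)$, $y'_j\in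 S_1(x')$. **Statement.** Let $(G,\sigma)$ and $(G',\sigma')$ be two $U(d)$-connection graphs whose signature groups $\Sigma$ and $\Sigma'$ commute elementwise, and let $\alpha,\beta>0$. For all $x\in V$, $x'\in V'$ and $N,N'\in(0,\infty]$, $$A_{N+N'}(x,x')=\begin{pmatrix}\alpha A_N(x)&\\&\beta A_{N'}(x')\end{pmatrix}+R(x,x')+J(x,x'),$$ where, with $a,\omega$ taken at $x$ and $a',\omega'$ at $x'$, $$R(x,x')=\begin{pmatrix}\alpha^{3}\overline{\omega}\left((\alpha^2a)^{\dagger}-(\alpha^2a+\beta^2a')^{\dagger}\right)\omega^{\top} & -\alpha^{3/2}\beta^{3/2}\overline{\omega}(\alpha^2a+\beta^2a')^{\dagger}(\omega')^{\top}\\ -\alpha^{3/2}\beta^{3/2}\overline{\omega'}(\alpha^2a+\beta^2a')^{\dagger}\omega^{\top} & \beta^3\overline{\omega'}\left((\beta^2a')^{\dagger}-(\alpha^2a+\beta^2a')^{\dagger}\right)(\omega')^{\top}\end{pmatrix},$$ $$J(x,x')=\frac{2}{N+N'}\begin{pmatrix}\alpha\frac{N'}{N}\mathbf v_0(x)\overline{\mathbf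 v_0(x)}^\top & -\sqrt{\alpha\beta}\,\mathbf v_0(x)\overline{\mathbf v_0(x')}^\top\\ -\sqrt{\alpha\beta}\,\mathbf v_0(x')\overline{\mathbf v_0(x)}^\top & \beta\frac{N}{N'}\mathbf v_0(x')\overline{\mathbf v_0(x')}^\top\end{pmatrix}.$$ If $N$ or $N'$ is infinite, the coefficients of $J$ are read as their limits: $\frac{2}{N+N'}=0$; $\frac{2}{N+N'}\cdot\frac{N'}{N}$ is $0$ if $N=\infty$ and $\frac2N$ if $N<N'=\infty$; and symmetrically for $\frac{2}{N+N'}\cdot\frac{N}{N'}$. Moreover, $J(x,x')$ is positive semidefinite. -/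

import Mathlib

open Matrix
open scoped ENNReal ComplexOrder

noncomputable section

/-! ### The Moore–Penrose pseudoinverse -/

/-- The four Penrose equations: `X` is the Moore–Penrose pseudoinverse of `A`. -/
structure IsMoorePenroseInverse {m n : Type*} [Fintype m] [Fintype n]
    (A : Matrix m n ℂ) (X : Matrix n m ℂ) : Prop where
  mul_mul_left : A * X * A = A
  mul_mul_right : X * A * X = X
  isHermitian_left : (A * X).IsHermitian
  isHermitian_right : (X * A).IsHermitian

theorem IsMoorePenroseInverse.unique {m n : Type*} [Fintype m] [Fintype n]
    {A : Matrix m n ℂ} {X Y : Matrix n m ℂ}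
    (hX : IsMoorePenroseInverse A X) (hY : IsMoorePenroseInverse A Y) : X = Y := by
  have e1 : A * X = A * Y := by
    calc A * X = (A * X)ᴴ := hX.isHermitian_left.symm
      _ = (A * Y * (A * X))ᴴ := by
          rw [← Matrix.mul_assoc, hY.mul_mul_left]
      _ = (A * X)ᴴ * (A * Y)ᴴ := Matrix.conjTranspose_mul _ _
      _ = A * X * (A * Y) := by rw [hX.isHermitian_left.eq, hY.isHermitian_left.eq]
      _ = A * Y := by rw [← Matrix.mul_assoc, hX.mul_mul_left]
  have e2 : X * A = Y * A := by
    calc X * A = (X * A)ᴴ := hX.isHermitian_right.symm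
      _ = (X * A * (Y * A))ᴴ := by
          rw [Matrix.mul_assoc X, ← Matrix.mul_assoc A, hY.mul_mul_left]
      _ = (Y * A)ᴴ * (X * A)ᴴ := Matrix.conjTranspose_mul _ _
      _ = Y * A * (X * A) := by rw [hX.isHermitian_right.eq, hY.isHermitian_right.eq]
      _ = Y * A := by rw [Matrix.mul_assoc Y, ← Matrix.mul_assoc A, hX.mul_mul_left]
  calc X = X * A * X := hX.mul_mul_right.symm
    _ = Y * A * Y := by rw [e2, Matrix.mul_assoc, e1, Matrix.mul_assoc]
    _ = Y := hY.mul_mul_right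

theorem exists_isMoorePenroseInverse {m n : Type*} [Fintype m] [Fintype n]
    (A : Matrix m n ℂ) : ∃ X, IsMoorePenroseInverse A X := by
  classical
  have hH : (Aᴴ * A).IsHermitian := Matrix.isHermitian_conjTranspose_mul_self A
  obtain ⟨K, hK, hHKH, hKHK, hcomm⟩ : ∃ K : Matrix n n ℂ, Kᴴ = K ∧
      (Aᴴ * A) * K * (Aᴴ * A) = Aᴴ * A ∧ K * (Aᴴ * A) * K = K ∧
      K * (Aᴴ * A) = (Aᴴ * A) * K := by
    let U : Matrix n n ℂ := hH.eigenvectorUnitary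
    let D : Matrix n n ℂ := diagonal (fun i => (hH.eigenvalues i : ℂ))
    let D' : Matrix n n ℂ := diagonal (fun i => ((hH.eigenvalues i)⁻¹ : ℂ))
    have hU : star U * U = 1 := Unitary.coe_star_mul_self hH.eigenvectorUnitary
    have hA : Aᴴ * A = U * D * star U := by
      have := hH.spectral_theorem
      rw [Unitary.conjStarAlgAut_apply] at this
      exact this
    have prod : ∀ P R : Matrix n n ℂ,
        (U * P * star U) * (U * R * star U) = U * (P * R) * star U := by
      intro P R
      calc (U * P * star U) * (U * R * star U)
          = U * P * (star U * U) * R * star U := by simp only [Matrix.mul_assoc]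
        _ = U * (P * R) * star U := by rw [hU]; simp only [Matrix.mul_assoc, Matrix.one_mul]
    refine ⟨U * D' * star U, ?_, ?_, ?_, ?_⟩
    · have : D'ᴴ = D' := by
        simp only [D', diagonal_conjTranspose]
        congr 1
        funext i
        simp
      rw [Matrix.conjTranspose_mul, Matrix.conjTranspose_mul, this, star_eq_conjTranspose,
        conjTranspose_conjTranspose, Matrix.mul_assoc]
    · rw [hA, prod, prod]
      congr 2
      simp only [D, D', diagonal_mul_diagonal]
      congr 1
      funext i
      exact mul_inv_mul_cancel _
    · rw [hA, prod, prod]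
      congr 2
      simp only [D, D', diagonal_mul_diagonal]
      congr 1
      funext i
      by_cases h0 : (hH.eigenvalues i : ℂ) = 0
      · simp [h0]
      · field_simp
    · rw [hA, prod, prod]
      congr 2
      simp only [D, D', diagonal_mul_diagonal]
      congr 1
      funext i
      exact mul_comm _ _
  refine ⟨K * Aᴴ, ?_, ?_, ?_, ?_⟩
  · have hz : (A * K * (Aᴴ * A) - A)ᴴ * (A * K * (Aᴴ * A) - A) = 0 := by
      have h2 : Aᴴ * (A * K * (Aᴴ * A) - A) = 0 := by
        rw [Matrix.mul_sub, show Aᴴ * (A * K * (Aᴴ * A)) = (Aᴴ * A) * K * (Aᴴ * A) by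
          simp only [Matrix.mul_assoc], hHKH, sub_self]
      have h3 : (A * K * (Aᴴ * A) - A)ᴴ = (K * (Aᴴ * A) - 1)ᴴ * Aᴴ := by
        rw [← Matrix.conjTranspose_mul, Matrix.mul_sub, Matrix.mul_one, Matrix.mul_assoc]
      rw [h3, Matrix.mul_assoc, h2, Matrix.mul_zero]
    have := sub_eq_zero.mp (Matrix.conjTranspose_mul_self_eq_zero.mp hz)
    simpa only [Matrix.mul_assoc] using this
  · rw [show K * Aᴴ * A * (K * Aᴴ) = K * (Aᴴ * A) * K * Aᴴ by simp only [Matrix.mul_assoc], hKHK]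
  · simp only [Matrix.IsHermitian, Matrix.conjTranspose_mul, conjTranspose_conjTranspose, hK,
      Matrix.mul_assoc]
  · have : (K * Aᴴ * A)ᴴ = (Aᴴ * A) * K := by
      rw [Matrix.mul_assoc, Matrix.conjTranspose_mul, hH.eq, hK]
    rw [Matrix.IsHermitian, this, ← hcomm, Matrix.mul_assoc]

/-- The Moore–Penrose pseudoinverse `A†` of a complex matrix. -/
def pinv {m n : Type*} [Fintype m] [Fintype n] (A : Matrix m n ℂ) : Matrix n m ℂ :=
  (exists_isMoorePenroseInverse A).choose

theorem pinv_spec {m n : Type*} [Fintype m] [Fintype n] (A : Matrix m n ℂ) :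
    IsMoorePenroseInverse A (pinv A) :=
  (exists_isMoorePenroseInverse A).choose_spec

/-! ### Connection graphs -/

/-- A locally finite weighted graph `(V, w, μ)` with a connection `σ : E^or → U(d)`. The connection
is stored as a function on all pairs of vertices; only its values on oriented edges, that is on
the pairs with `w x y ≠ 0`, are constrained and matter. -/
structure ConnectionGraph (V : Type*) (d : ℕ) where
  w : V → V → ℝ
  mu : V → ℝ
  conn : V → V → Matrix.unitaryGroup (Fin d) ℂ
  w_nonneg : ∀ x y, 0 ≤ w x y
  w_symm : ∀ x y, w x y = w y x
  w_self : ∀ x, w x x = 0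
  mu_pos : ∀ x, 0 < mu x
  locallyFinite : ∀ x, {y | w x y ≠ 0}.Finite
  conn_symm : ∀ x y, w x y ≠ 0 → conn x y = (conn y x)⁻¹

namespace ConnectionGraph

variable {V V' : Type*} {d : ℕ}

/-- The underlying simple graph. -/
def graph (G : ConnectionGraph V d) : SimpleGraph V where
  Adj x y := G.w x y ≠ 0
  symm := ⟨fun x y h => by rwa [G.w_symm y x]⟩
  loopless := ⟨fun x h => h (G.w_self x)⟩

/-- The finite set of neighbours of `x`. -/
def nbrs (G : ConnectionGraph V d) (x : V) : Finset V := (G.locallyFinite x).toFinset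

theorem mem_nbrs (G : ConnectionGraph V d) {x y : V} : y ∈ G.nbrs x ↔ G.w x y ≠ 0 := by
  simp [nbrs]

/-- The sphere `S_r(x)` for the graph distance. -/
def sphere (G : ConnectionGraph V d) (x : V) (r : ℕ) : Set V := {y | G.graph.edist x y = r}

theorem mem_sphere_one (G : ConnectionGraph V d) {x y : V} :
    y ∈ G.sphere x 1 ↔ G.w x y ≠ 0 := by
  change G.graph.edist x y = ((1 : ℕ) : ℕ∞) ↔ _
  rw [Nat.cast_one, SimpleGraph.edist_eq_one_iff_adj]
  rfl

theorem sphere_one_finite (G : ConnectionGraph V d) (x : V) : (G.sphere x 1).Finite :=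
  (G.locallyFinite x).subset fun _ hy => G.mem_sphere_one.mp hy

theorem sphere_two_finite (G : ConnectionGraph V d) (x : V) : (G.sphere x 2).Finite := by
  refine ((G.locallyFinite x).biUnion fun y _ => G.locallyFinite y).subset ?_
  intro z hz
  obtain ⟨p, hp⟩ := SimpleGraph.exists_walk_of_edist_eq_coe hz
  cases p with
  | nil => simp at hp
  | cons h q =>
    cases q with
    | nil => simp at hp
    | cons h' r =>
      cases r with
      | nil => exact Set.mem_biUnion h h'
      | cons h'' s => simp at hp

instance (G : ConnectionGraph V d) (x : V) : Fintype (G.sphere x 1) :=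
  (G.sphere_one_finite x).fintype

instance (G : ConnectionGraph V d) (x : V) : Fintype (G.sphere x 2) :=
  (G.sphere_two_finite x).fintype

/-- The degree `d_x`. -/
def degree (G : ConnectionGraph V d) (x : V) : ℝ := ∑ y ∈ G.nbrs x, G.w x y

/-- The transition rate `p_{xy} = w_{xy} / μ_x`. -/
def p (G : ConnectionGraph V d) (x y : V) : ℝ := G.w x y / G.mu x

/-- The signature group, generated by the values of the connection on the oriented edges. -/
def signatureGroup (G : ConnectionGraph V d) : Subgroup (Matrix.unitaryGroup (Fin d) ℂ) :=
  Subgroup.closure {g | ∃ x y, G.w x y ≠ 0 ∧ G.conn x y = g}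

/-! ### The operators `Δ`, `Δ^σ`, `Γ^σ`, `Γ₂^σ` -/

/-- The Laplacian on scalar functions. -/
def lap (G : ConnectionGraph V d) (h : V → ℂ) (x : V) : ℂ :=
  ∑ y ∈ G.nbrs x, (G.p x y : ℂ) * (h y - h x)

/-- The connection Laplacian `Δ^σ` on vector-valued functions. -/
def connLap (G : ConnectionGraph V d) (f : V → Fin d → ℂ) (x : V) : Fin d → ℂ :=
  ∑ y ∈ G.nbrs x, (G.p x y : ℂ) • ((G.conn x y : Matrix (Fin d) (Fin d) ℂ) *ᵥ f y - f x)

/-- `2 Γ^σ(f,g) = Δ(fᵀ ḡ) - fᵀ conj(Δ^σ g) - (Δ^σ f)ᵀ ḡ`. -/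
def Gam (G : ConnectionGraph V d) (f g : V → Fin d → ℂ) (x : V) : ℂ :=
  (1 / 2) * (G.lap (fun y => f y ⬝ᵥ star (g y)) x
    - f x ⬝ᵥ star (G.connLap g x) - G.connLap f x ⬝ᵥ star (g x))

/-- `2 Γ₂^σ(f,g) = Δ(Γ^σ(f,g)) - Γ^σ(f, Δ^σ g) - Γ^σ(Δ^σ f, g)`. -/
def Gam2 (G : ConnectionGraph V d) (f g : V → Fin d → ℂ) (x : V) : ℂ :=
  (1 / 2) * (G.lap (G.Gam f g) x - G.Gam f (G.connLap g) x - G.Gam (G.connLap f) g x)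

/-! ### Local matrices

Vectors on `B₁(x) = {x} ∪ S₁(x)` are indexed by `Fin d ⊕ S₁(x) × Fin d`. -/

open Classical in
/-- The function with value the `i`-th standard basis vector at `u` and `0` elsewhere. -/
def basisFun (u : V × Fin d) : V → Fin d → ℂ := Pi.single u.1 (Pi.single u.2 1)

/-- The vertex and coordinate belonging to an index of `B₁(x)`. -/
def idxB1 (G : ConnectionGraph V d) (x : V) : Fin d ⊕ (G.sphere x 1 × Fin d) → V × Fin d :=
  Sum.elim (fun i => (x, i)) (fun q => (q.1, q.2))

/-- The vertex and coordinate belonging to an index of `S₂(x)`. -/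
def idxS2 (G : ConnectionGraph V d) (x : V) : G.sphere x 2 × Fin d → V × Fin d :=
  fun q => (q.1, q.2)

/-- The matrix of the sesquilinear form `Γ₂^σ` at `x`, so that `fᵀ Γ₂^σ(x) ḡ = Γ₂^σ(f,g)(x)`. -/
def Gam2Matrix (G : ConnectionGraph V d) (x : V) : Matrix (V × Fin d) (V × Fin d) ℂ :=
  Matrix.of fun u v => G.Gam2 (basisFun u) (basisFun v) x

open Classical in
/-- The matrix `Q(x)`: the Schur complement of the block `Γ₂^σ(x)_{S₂,S₂}` in `Γ₂^σ(x)`. -/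
def Q (G : ConnectionGraph V d) (x : V) :
    Matrix (Fin d ⊕ (G.sphere x 1 × Fin d)) (Fin d ⊕ (G.sphere x 1 × Fin d)) ℂ :=
  (G.Gam2Matrix x).submatrix (G.idxB1 x) (G.idxB1 x)
    - (G.Gam2Matrix x).submatrix (G.idxB1 x) (G.idxS2 x)
      * ((G.Gam2Matrix x).submatrix (G.idxS2 x) (G.idxS2 x))⁻¹
      * (G.Gam2Matrix x).submatrix (G.idxS2 x) (G.idxB1 x)

/-- The `(m+1)d × d` matrix `Δ^σ(x)`, whose transpose is
`( -(d_x/μ_x) I, p_{xy₁} σ_{xy₁}, …, p_{xy_m} σ_{xy_m} )`. -/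
def lapMatrix (G : ConnectionGraph V d) (x : V) :
    Matrix (Fin d ⊕ (G.sphere x 1 × Fin d)) (Fin d) ℂ :=
  Matrix.fromRows ((-(G.degree x / G.mu x : ℝ) : ℂ) • (1 : Matrix (Fin d) (Fin d) ℂ))
    (Matrix.of fun q j =>
      (G.p x q.1 : ℂ) * (G.conn x q.1 : Matrix (Fin d) (Fin d) ℂ)ᵀ q.2 j)

open Classical in
/-- The canonical matrix `B₀`: first block row `(I, conj σ_{xy₁}, …, conj σ_{xy_m})`, and
below it `(0, diag(p_{xyᵢ}^{-1/2} I))`. -/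
def B0 (G : ConnectionGraph V d) (x : V) :
    Matrix (Fin d ⊕ (G.sphere x 1 × Fin d)) (Fin d ⊕ (G.sphere x 1 × Fin d)) ℂ :=
  Matrix.fromBlocks 1
    (Matrix.of fun i q => star ((G.conn x q.1 : Matrix (Fin d) (Fin d) ℂ) i q.2))
    0 (Matrix.diagonal fun q => ((1 / Real.sqrt (G.p x q.1) : ℝ) : ℂ))

/-! ### Curvature matrices with respect to a matrix `B` -/

/-- The matrix `2 B Q(x) B̄ᵀ`. -/
def BQB (G : ConnectionGraph V d) (x : V)
    (B : Matrix (Fin d ⊕ (G.sphere x 1 × Fin d)) (Fin d ⊕ (G.sphere x 1 × Fin d)) ℂ) :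
    Matrix (Fin d ⊕ (G.sphere x 1 × Fin d)) (Fin d ⊕ (G.sphere x 1 × Fin d)) ℂ :=
  (2 : ℂ) • (B * G.Q x * Bᴴ)

/-- The upper left `d × d` block `a` of `2 B Q(x) B̄ᵀ`. -/
def a (G : ConnectionGraph V d) (x : V)
    (B : Matrix (Fin d ⊕ (G.sphere x 1 × Fin d)) (Fin d ⊕ (G.sphere x 1 × Fin d)) ℂ) :
    Matrix (Fin d) (Fin d) ℂ :=
  (G.BQB x B).toBlocks₁₁

/-- The upper right block `ωᵀ` of `2 B Q(x) B̄ᵀ`; the matrix `ω̄` is `(G.omegaT x B)ᴴ`. -/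
def omegaT (G : ConnectionGraph V d) (x : V)
    (B : Matrix (Fin d ⊕ (G.sphere x 1 × Fin d)) (Fin d ⊕ (G.sphere x 1 × Fin d)) ℂ) :
    Matrix (Fin d) (G.sphere x 1 × Fin d) ℂ :=
  (G.BQB x B).toBlocks₁₂

/-- The lower `md × d` block `v₀(x)` of `B Δ^σ(x)`. -/
def v0 (G : ConnectionGraph V d) (x : V)
    (B : Matrix (Fin d ⊕ (G.sphere x 1 × Fin d)) (Fin d ⊕ (G.sphere x 1 × Fin d)) ℂ) :
    Matrix (G.sphere x 1 × Fin d) (Fin d) ℂ :=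
  (B * G.lapMatrix x).toRows₂

/-- The curvature matrix `A_∞(G,σ,x,B) = (2 B Q(x) B̄ᵀ)_{1̂} - ω̄ a† ωᵀ`. -/
def AInf (G : ConnectionGraph V d) (x : V)
    (B : Matrix (Fin d ⊕ (G.sphere x 1 × Fin d)) (Fin d ⊕ (G.sphere x 1 × Fin d)) ℂ) :
    Matrix (G.sphere x 1 × Fin d) (G.sphere x 1 × Fin d) ℂ :=
  (G.BQB x B).toBlocks₂₂ - (G.omegaT x B)ᴴ * pinv (G.a x B) * G.omegaT x B

/-- The curvature matrix `A_N(G,σ,x,B) = A_∞(G,σ,x,B) - (2/N) v₀ v̄₀ᵀ` for `N ∈ (0,∞]`,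
where `2/∞ = 0`. -/
def A (G : ConnectionGraph V d) (N : ℝ≥0∞) (x : V)
    (B : Matrix (Fin d ⊕ (G.sphere x 1 × Fin d)) (Fin d ⊕ (G.sphere x 1 × Fin d)) ℂ) :
    Matrix (G.sphere x 1 × Fin d) (G.sphere x 1 × Fin d) ℂ :=
  G.AInf x B - ((2 / N).toReal : ℂ) • (G.v0 x B * (G.v0 x B)ᴴ)

/-- The explicit form of `B₀ Δ^σ(x)`; in particular the block of `v₀(x)` at `y` is
`√p_{xy} σ_{xy}ᵀ`. -/
theorem B0_mul_lapMatrix (G : ConnectionGraph V d) (x : V) :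
    G.B0 x * G.lapMatrix x = Matrix.fromRows 0 (Matrix.of fun q j =>
      ((Real.sqrt (G.p x q.1) : ℝ) : ℂ) * (G.conn x q.1 : Matrix (Fin d) (Fin d) ℂ)ᵀ q.2 j) := by
  classical
  have hp : ∀ y : G.sphere x 1, 0 < G.p x y := fun y =>
    div_pos (lt_of_le_of_ne (G.w_nonneg _ _) (Ne.symm (G.mem_sphere_one.mp y.2))) (G.mu_pos x)
  have hdeg : G.degree x / G.mu x = ∑ y : G.sphere x 1, G.p x y := by
    rw [degree, Finset.sum_div]
    refine (Finset.sum_subtype (G.nbrs x) (p := fun y => y ∈ G.sphere x 1) (fun y => ?_)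
      (fun y => G.w x y / G.mu x)).trans rfl
    rw [mem_nbrs, mem_sphere_one]
  rw [B0, lapMatrix, Matrix.fromBlocks_mul_fromRows]
  congr 1
  · rw [hdeg]
    ext i j
    have hU : ∀ y : G.sphere x 1, ∑ k, star ((G.conn x y : Matrix (Fin d) (Fin d) ℂ) i k) *
        (G.conn x y : Matrix (Fin d) (Fin d) ℂ) j k = (1 : Matrix (Fin d) (Fin d) ℂ) i j := by
      intro y
      have h := congrFun (congrFun (Matrix.mem_unitaryGroup_iff.mp (G.conn x y).2) j) i
      rw [Matrix.mul_apply] at h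
      rw [show (1 : Matrix (Fin d) (Fin d) ℂ) i j = (1 : Matrix (Fin d) (Fin d) ℂ) j i by
        simp [Matrix.one_apply, eq_comm], ← h]
      exact Finset.sum_congr rfl fun k _ => mul_comm _ _
    have hs : ∑ q : G.sphere x 1 × Fin d, star ((G.conn x q.1 : Matrix (Fin d) (Fin d) ℂ) i q.2) *
        ((G.p x q.1 : ℂ) * (G.conn x q.1 : Matrix (Fin d) (Fin d) ℂ) j q.2)
        = (∑ y : G.sphere x 1, (G.p x y : ℂ)) * (1 : Matrix (Fin d) (Fin d) ℂ) i j := by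
      rw [Fintype.sum_prod_type, Finset.sum_mul]
      refine Finset.sum_congr rfl fun y _ => ?_
      rw [← hU y, Finset.mul_sum]
      exact Finset.sum_congr rfl fun k _ => by ring
    simp only [Matrix.one_mul, Matrix.add_apply, Matrix.smul_apply, Matrix.mul_apply,
      Matrix.of_apply, Matrix.transpose_apply, Matrix.zero_apply, smul_eq_mul]
    rw [hs]
    push_cast
    ring
  · rw [Matrix.zero_mul, zero_add]
    ext q j
    rw [Matrix.diagonal_mul, Matrix.of_apply, Matrix.of_apply, ← mul_assoc, ← Complex.ofReal_mul,
      one_div_mul_eq_div, Real.div_sqrt]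

/-! ### The Cartesian product -/

open Classical in
/-- The Cartesian product `(G,σ) ×_{α,β} (G',σ')`. -/
def prod (α β : ℝ) (hα : 0 < α) (hβ : 0 < β)
    (G : ConnectionGraph V d) (G' : ConnectionGraph V' d) : ConnectionGraph (V × V') d where
  w u v := if u.2 = v.2 then α * G.w u.1 v.1 * G'.mu u.2
    else if u.1 = v.1 then β * G'.w u.2 v.2 * G.mu u.1 else 0
  mu u := G.mu u.1 * G'.mu u.2
  conn u v := if u.2 = v.2 then G.conn u.1 v.1
    else if u.1 = v.1 then G'.conn u.2 v.2 else 1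
  w_nonneg u v := by
    have h1 := mul_nonneg (mul_nonneg hα.le (G.w_nonneg u.1 v.1)) (G'.mu_pos u.2).le
    have h2 := mul_nonneg (mul_nonneg hβ.le (G'.w_nonneg u.2 v.2)) (G.mu_pos u.1).le
    split_ifs <;> first | assumption | exact le_rfl
  w_symm u v := by
    by_cases h2 : u.2 = v.2
    · simp [h2, G.w_symm u.1 v.1]
    · by_cases h1 : u.1 = v.1
      · simp [h2, Ne.symm h2, h1, G'.w_symm u.2 v.2]
      · simp [h2, Ne.symm h2, h1, Ne.symm h1]
  w_self u := by simp [G.w_self]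
  mu_pos u := mul_pos (G.mu_pos u.1) (G'.mu_pos u.2)
  locallyFinite u := by
    refine (((G.locallyFinite u.1).image fun y => (y, u.2)).union
      ((G'.locallyFinite u.2).image fun y' => (u.1, y'))).subset ?_
    rintro ⟨y, y'⟩ h
    rw [Set.mem_ofPred_eq] at h
    dsimp only at h
    by_cases h2 : u.2 = y'
    · left
      refine ⟨y, ?_, by simp [h2]⟩
      intro h0
      simp [h2, h0] at h
    · by_cases h1 : u.1 = y
      · right
        refine ⟨y', ?_, by simp [h1]⟩
        intro h0
        simp [h2, h1, h0] at h
      · simp [h1, h2] at h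
  conn_symm u v h := by
    by_cases h2 : u.2 = v.2
    · have h0 : G.w u.1 v.1 ≠ 0 := by
        intro h0
        simp [h2, h0] at h
      simp only [h2, if_true]
      exact G.conn_symm _ _ h0
    · by_cases h1 : u.1 = v.1
      · have h0 : G'.w u.2 v.2 ≠ 0 := by
          intro h0
          simp [h2, h1, h0] at h
        simp only [h2, Ne.symm h2, h1, if_true, if_false]
        exact G'.conn_symm _ _ h0
      · simp [h2, Ne.symm h2, h1, Ne.symm h1]

/-- `S₁(x,x')` consists of the vertices `(y,x')` with `y ∈ S₁(x)` and `(x,y')` with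
`y' ∈ S₁(x')`. -/
def sphereMap (α β : ℝ) (hα : 0 < α) (hβ : 0 < β)
    (G : ConnectionGraph V d) (G' : ConnectionGraph V' d) (x : V) (x' : V') :
    G.sphere x 1 ⊕ G'.sphere x' 1 → (prod α β hα hβ G G').sphere (x, x') 1 :=
  Sum.elim
    (fun y => ⟨(y, x'), by
      rw [mem_sphere_one]
      have := G.mem_sphere_one.mp y.2
      simp [prod, hα.ne', this, (G'.mu_pos x').ne']⟩)
    (fun y' => ⟨(x, y'), by
      rw [mem_sphere_one]
      have h := G'.mem_sphere_one.mp y'.2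
      have hne : x' ≠ y'.1 := fun e => h (by rw [← e]; exact G'.w_self x')
      simp [prod, hβ.ne', h, (G.mu_pos x).ne', hne]⟩)

theorem sphereMap_bijective (α β : ℝ) (hα : 0 < α) (hβ : 0 < β)
    (G : ConnectionGraph V d) (G' : ConnectionGraph V' d) (x : V) (x' : V') :
    Function.Bijective (sphereMap α β hα hβ G G' x x') := by
  constructor
  · rintro (⟨y, hy⟩ | ⟨y', hy'⟩) (⟨z, hz⟩ | ⟨z', hz'⟩) h
    · simpa [sphereMap] using h
    · have h := congrArg (fun t => (t.1).1) h
      simp only [sphereMap, Sum.elim_inl, Sum.elim_inr] at h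
      subst h
      exact absurd (G.w_self _) (G.mem_sphere_one.mp hy)
    · have h := congrArg (fun t => (t.1).1) h
      simp only [sphereMap, Sum.elim_inl, Sum.elim_inr] at h
      subst h
      exact absurd (G.w_self _) (G.mem_sphere_one.mp hz)
    · simpa [sphereMap] using h
  · rintro ⟨⟨y, y'⟩, h⟩
    have h' := (mem_sphere_one _).mp h
    by_cases h2 : x' = y'
    · have h0 : G.w x y ≠ 0 := by
        intro h0
        simp [prod, h2, h0] at h'
      exact ⟨Sum.inl ⟨y, G.mem_sphere_one.mpr h0⟩, by simp [sphereMap, h2]⟩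
    · by_cases h1 : x = y
      · have h0 : G'.w x' y' ≠ 0 := by
          intro h0
          simp [prod, h2, h1, h0] at h'
        exact ⟨Sum.inr ⟨y', G'.mem_sphere_one.mpr h0⟩, by simp [sphereMap, h1]⟩
      · simp [prod, h1, h2] at h'

/-- The order of the rows and columns of the matrices at `(x,x')`: first those belonging to
`S₁(x)`, then those belonging to `S₁(x')`. -/
def prodIndex (α β : ℝ) (hα : 0 < α) (hβ : 0 < β)
    (G : ConnectionGraph V d) (G' : ConnectionGraph V' d) (x : V) (x' : V') :
    (G.sphere x 1 × Fin d) ⊕ (G'.sphere x' 1 × Fin d) ≃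
      (prod α β hα hβ G G').sphere (x, x') 1 × Fin d :=
  (Equiv.sumProdDistrib _ _ _).symm.trans
    ((Equiv.ofBijective _ (sphereMap_bijective α β hα hβ G G' x x')).prodCongr (Equiv.refl _))

/-! ### The matrices `R(x,x')` and `J(x,x')` -/

/-- The matrix `R(x,x')`, with `a, a', ω, ω'` taken with respect to `B₀`. -/
def R (α β : ℝ) (G : ConnectionGraph V d) (G' : ConnectionGraph V' d) (x : V) (x' : V') :
    Matrix ((G.sphere x 1 × Fin d) ⊕ (G'.sphere x' 1 × Fin d))
      ((G.sphere x 1 × Fin d) ⊕ (G'.sphere x' 1 × Fin d)) ℂ :=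
  let a₁ : Matrix (Fin d) (Fin d) ℂ := ((α ^ 2 : ℝ) : ℂ) • G.a x (G.B0 x)
  let a₂ : Matrix (Fin d) (Fin d) ℂ := ((β ^ 2 : ℝ) : ℂ) • G'.a x' (G'.B0 x')
  let ωT := G.omegaT x (G.B0 x)
  let ωT' := G'.omegaT x' (G'.B0 x')
  let c : ℂ := ((α ^ (3 / 2 : ℝ) * β ^ (3 / 2 : ℝ) : ℝ) : ℂ)
  Matrix.fromBlocks
    (((α ^ 3 : ℝ) : ℂ) • (ωTᴴ * (pinv a₁ - pinv (a₁ + a₂)) * ωT))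
    (-(c • (ωTᴴ * pinv (a₁ + a₂) * ωT')))
    (-(c • (ωT'ᴴ * pinv (a₁ + a₂) * ωT)))
    (((β ^ 3 : ℝ) : ℂ) • (ωT'ᴴ * (pinv a₂ - pinv (a₁ + a₂)) * ωT'))

/-- The number `(2 / (N + N')) * (N' / N)`, extended continuously to `(0,∞]²`: it is `0` for
`N = ∞`, and `2 / N` for `N' = ∞` and `N` finite. -/
def jCoeff (N N' : ℝ≥0∞) : ℝ :=
  if N = ⊤ then 0
  else if N' = ⊤ then 2 / N.toReal
  else 2 / (N.toReal + N'.toReal) * (N'.toReal / N.toReal)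

/-- The matrix `J(x,x')`, with `v₀(x)` and `v₀(x')` taken with respect to `B₀`. -/
def J (α β : ℝ) (N N' : ℝ≥0∞) (G : ConnectionGraph V d) (G' : ConnectionGraph V' d)
    (x : V) (x' : V') :
    Matrix ((G.sphere x 1 × Fin d) ⊕ (G'.sphere x' 1 × Fin d))
      ((G.sphere x 1 × Fin d) ⊕ (G'.sphere x' 1 × Fin d)) ℂ :=
  let v := G.v0 x (G.B0 x)
  let v' := G'.v0 x' (G'.B0 x')
  let c : ℂ := (((2 / (N + N')).toReal * Real.sqrt (α * β) : ℝ) : ℂ)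
  Matrix.fromBlocks
    (((α * jCoeff N N' : ℝ) : ℂ) • (v * vᴴ))
    (-(c • (v * v'ᴴ)))
    (-(c • (v' * vᴴ)))
    (((β * jCoeff N' N : ℝ) : ℂ) • (v' * v'ᴴ))

end ConnectionGraph

end

open Matrix
open scoped ENNReal ComplexOrder

noncomputable section

namespace ConnectionGraph

variable {V V' : Type*} {d : ℕ}

/-! ### An explicit formula for `Γ₂^σ` -/

/-! The matrix `Q` is governed by a minimisation-like principle. The form `bᵀ Q(x) c̄` equals
`Γ₂^σ(f,g)(x)` for any extension `f` of `b` from `B₁(x)`, provided `g` extends `c` so that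
`Γ₂^σ(·,g)(x)` kills every function supported on `S₂(x)` (`valB1_dotProduct_Q`). Such an optimal `g`
exists because the `S₂` block is diagonal with positive entries (`exists_isOptimal`).

On the product, a path of two edges either stays in one slice or goes round a corner of a square.
The signature groups commute, so the two ways round the square reach the opposite vertex with the
same transport. Hence `Γ₂^σ` of the product is `α²Γ₂^σ + β²Γ₂^{σ'}` plus a weighted sum of products
of mixed second differences (`prod_Gam2`). Given optimal extensions in the two slices, the values at
the opposite corners can be solved so that all mixed differences vanish. The resulting function is
optimal for the product (`isOptimal_prod`), and the form of `Q` splits with weights `α²` and `β²`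
(`prod_Q_form`).

The rest is bookkeeping with `B₀`. Its upper rows restrict to those of the factors, and each lower
row lives on one factor and is rescaled by `α^{-1/2}` or `β^{-1/2}`. So `a` adds up, `ω` is
concatenated and `C` is block diagonal. The Schur complement of the sum `α²a + β²a'` differs from
those of the factors by exactly `R`, and `J` accounts for the change of dimension in the `v₀` terms.
Finally `J = u uᴴ`, because its two diagonal coefficients multiply to the square of the off-diagonal
one. -/

/-- The covariant difference `σ_{xy} f(y) - f(x)`. -/
def diff (G : ConnectionGraph V d) (x y : V) (f : V → Fin d → ℂ) : Fin d → ℂ :=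
  (G.conn x y : Matrix (Fin d) (Fin d) ℂ) *ᵥ f y - f x

/-- The covariant second difference `σ_{xy} σ_{yz} f(z) - 2 σ_{xy} f(y) + f(x)`. -/
def diff₂ (G : ConnectionGraph V d) (x y z : V) (f : V → Fin d → ℂ) : Fin d → ℂ :=
  (G.conn x y : Matrix (Fin d) (Fin d) ℂ) *ᵥ G.diff y z f - G.diff x y f

/-- The total transition rate `d_x / μ_x`. -/
def rate (G : ConnectionGraph V d) (x : V) : ℂ := ∑ y ∈ G.nbrs x, (G.p x y : ℂ)

theorem unitary_mulVec_dotProduct (U : Matrix.unitaryGroup (Fin d) ℂ) (u v : Fin d → ℂ) :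
    ((U : Matrix (Fin d) (Fin d) ℂ) *ᵥ u) ⬝ᵥ star ((U : Matrix (Fin d) (Fin d) ℂ) *ᵥ v)
      = u ⬝ᵥ star v := by
  have h : (U : Matrix (Fin d) (Fin d) ℂ)ᴴ * (U : Matrix (Fin d) (Fin d) ℂ) = 1 :=
    Matrix.mem_unitaryGroup_iff'.mp U.2
  rw [Matrix.star_mulVec, dotProduct_comm, ← Matrix.dotProduct_mulVec, Matrix.mulVec_mulVec, h,
    Matrix.one_mulVec, dotProduct_comm]

theorem connLap_eq_sum_diff (G : ConnectionGraph V d) (f : V → Fin d → ℂ) (x : V) :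
    G.connLap f x = ∑ y ∈ G.nbrs x, (G.p x y : ℂ) • G.diff x y f := rfl

theorem star_ofReal_smul (r : ℝ) (v : Fin d → ℂ) : star ((r : ℂ) • v) = (r : ℂ) • star v := by
  rw [star_smul, RCLike.star_def, Complex.conj_ofReal]

theorem dotProduct_star_connLap (G : ConnectionGraph V d) (g : V → Fin d → ℂ) (x : V)
    (u : Fin d → ℂ) :
    u ⬝ᵥ star (G.connLap g x) = ∑ y ∈ G.nbrs x, (G.p x y : ℂ) * (u ⬝ᵥ star (G.diff x y g)) := by
  simp only [connLap_eq_sum_diff, star_sum, star_ofReal_smul, dotProduct_sum, dotProduct_smul,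
    smul_eq_mul]

theorem connLap_dotProduct (G : ConnectionGraph V d) (f : V → Fin d → ℂ) (x : V)
    (u : Fin d → ℂ) :
    G.connLap f x ⬝ᵥ u = ∑ y ∈ G.nbrs x, (G.p x y : ℂ) * (G.diff x y f ⬝ᵥ u) := by
  simp only [connLap_eq_sum_diff, sum_dotProduct, smul_dotProduct, smul_eq_mul]

/-- Since `σ_{xy}` is unitary, `f(y)ᵀ conj g(y)` may be computed after transport to `x`, and the
product rule for differences leaves only the product of the covariant differences. -/
theorem Gam_eq (G : ConnectionGraph V d) (f g : V → Fin d → ℂ) (x : V) :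
    G.Gam f g x =
      1 / 2 * ∑ y ∈ G.nbrs x, (G.p x y : ℂ) * (G.diff x y f ⬝ᵥ star (G.diff x y g)) := by
  rw [Gam, lap, dotProduct_star_connLap, connLap_dotProduct, ← Finset.sum_sub_distrib,
    ← Finset.sum_sub_distrib]
  congr 1
  refine Finset.sum_congr rfl fun y _ => ?_
  rw [← unitary_mulVec_dotProduct (G.conn x y) (f y) (g y)]
  simp only [diff, star_sub, sub_dotProduct, dotProduct_sub]
  ring

/-- Completing the square. The term `Δ Γ^σ` gives the products of differences along the edges `yz`,
and the other two terms give their pairings with the differences along `xy`. Together they form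
products of second differences, at the cost of the `rate y` term. The `rate x` term is the `-Γ^σ(x)`
part of the Laplacian. -/
theorem Gam2_eq (G : ConnectionGraph V d) (f g : V → Fin d → ℂ) (x : V) :
    4 * G.Gam2 f g x =
      ∑ y ∈ G.nbrs x, (G.p x y : ℂ) * ∑ z ∈ G.nbrs y, (G.p y z : ℂ) *
          (G.diff₂ x y z f ⬝ᵥ star (G.diff₂ x y z g))
        - ∑ y ∈ G.nbrs x, (G.p x y : ℂ) * ((G.rate x + G.rate y) *
          (G.diff x y f ⬝ᵥ star (G.diff x y g)))
        + 2 * (G.connLap f x ⬝ᵥ star (G.connLap g x)) := by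
  have h1 : ∀ y, (G.diff x y f ⬝ᵥ star (G.diff x y (G.connLap g)))
      = ∑ z ∈ G.nbrs y, (G.p y z : ℂ) * (G.diff x y f ⬝ᵥ
          star ((G.conn x y : Matrix (Fin d) (Fin d) ℂ) *ᵥ G.diff y z g))
        - G.diff x y f ⬝ᵥ star (G.connLap g x) := by
    intro y
    rw [diff, diff, star_sub, dotProduct_sub, connLap_eq_sum_diff G g y, Matrix.mulVec_sum]
    simp only [Matrix.mulVec_smul, star_sum, star_ofReal_smul, dotProduct_sum, dotProduct_smul,
      smul_eq_mul]
  have h2 : ∀ y, (G.diff x y (G.connLap f) ⬝ᵥ star (G.diff x y g))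
      = ∑ z ∈ G.nbrs y, (G.p y z : ℂ) * (((G.conn x y : Matrix (Fin d) (Fin d) ℂ) *ᵥ
          G.diff y z f) ⬝ᵥ star (G.diff x y g))
        - G.connLap f x ⬝ᵥ star (G.diff x y g) := by
    intro y
    rw [diff, sub_dotProduct, connLap_eq_sum_diff G f y, Matrix.mulVec_sum]
    simp only [Matrix.mulVec_smul, sum_dotProduct, smul_dotProduct, smul_eq_mul]
  -- One copy comes from each of `Γ^σ(f, Δ^σ g)` and `Γ^σ(Δ^σ f, g)`, through the value of the
  -- Laplacian at `x` itself.
  have h3 : 2 * (G.connLap f x ⬝ᵥ star (G.connLap g x))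
      = ∑ y ∈ G.nbrs x, (G.p x y : ℂ) * (G.diff x y f ⬝ᵥ star (G.connLap g x))
      + ∑ y ∈ G.nbrs x, (G.p x y : ℂ) * (G.connLap f x ⬝ᵥ star (G.diff x y g)) := by
    rw [← connLap_dotProduct, ← dotProduct_star_connLap]
    ring
  have h4 : G.rate x * ∑ y ∈ G.nbrs x, (G.p x y : ℂ) * (G.diff x y f ⬝ᵥ star (G.diff x y g))
      = ∑ y ∈ G.nbrs x, (G.p x y : ℂ) * ∑ z ∈ G.nbrs x, (G.p x z : ℂ) *
        (G.diff x z f ⬝ᵥ star (G.diff x z g)) := by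
    rw [rate, Finset.sum_mul]
  rw [h3, Gam2, lap]
  simp only [Gam_eq, h1, h2]
  calc _ = ∑ y ∈ G.nbrs x, ((G.p x y : ℂ) * (∑ z ∈ G.nbrs y, (G.p y z : ℂ) *
              (G.diff y z f ⬝ᵥ star (G.diff y z g))
            - ∑ z ∈ G.nbrs x, (G.p x z : ℂ) * (G.diff x z f ⬝ᵥ star (G.diff x z g))))
          - ∑ y ∈ G.nbrs x, (G.p x y : ℂ) * (∑ z ∈ G.nbrs y, (G.p y z : ℂ) *
              (G.diff x y f ⬝ᵥ star ((G.conn x y : Matrix (Fin d) (Fin d) ℂ) *ᵥ G.diff y z g))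
            - G.diff x y f ⬝ᵥ star (G.connLap g x))
          - ∑ y ∈ G.nbrs x, (G.p x y : ℂ) * (∑ z ∈ G.nbrs y, (G.p y z : ℂ) *
              (((G.conn x y : Matrix (Fin d) (Fin d) ℂ) *ᵥ G.diff y z f) ⬝ᵥ star (G.diff x y g))
            - G.connLap f x ⬝ᵥ star (G.diff x y g)) := by
        simp only [← mul_sub, mul_left_comm (_ : ℂ) (1 / 2 : ℂ), ← Finset.mul_sum]
        ring
    _ = _ := by
        simp only [mul_add, add_mul, mul_sub, Finset.sum_sub_distrib, Finset.sum_add_distrib]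
        have h5 : ∑ y ∈ G.nbrs x, (G.p x y : ℂ) * ∑ z ∈ G.nbrs y, (G.p y z : ℂ) *
              (G.diff₂ x y z f ⬝ᵥ star (G.diff₂ x y z g))
            = ∑ y ∈ G.nbrs x, (G.p x y : ℂ) * ∑ z ∈ G.nbrs y, (G.p y z : ℂ) *
                (G.diff y z f ⬝ᵥ star (G.diff y z g))
              - ∑ y ∈ G.nbrs x, (G.p x y : ℂ) * ∑ z ∈ G.nbrs y, (G.p y z : ℂ) *
                (G.diff x y f ⬝ᵥ star ((G.conn x y : Matrix (Fin d) (Fin d) ℂ) *ᵥ G.diff y z g))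
              - ∑ y ∈ G.nbrs x, (G.p x y : ℂ) * ∑ z ∈ G.nbrs y, (G.p y z : ℂ) *
                (((G.conn x y : Matrix (Fin d) (Fin d) ℂ) *ᵥ G.diff y z f) ⬝ᵥ
                  star (G.diff x y g))
              + ∑ y ∈ G.nbrs x, (G.p x y : ℂ) * (G.rate y *
                (G.diff x y f ⬝ᵥ star (G.diff x y g))) := by
          rw [← Finset.sum_sub_distrib, ← Finset.sum_sub_distrib, ← Finset.sum_add_distrib]
          refine Finset.sum_congr rfl fun y _ => ?_
          rw [rate, Finset.sum_mul, ← mul_sub, ← mul_sub, ← mul_add, ← Finset.sum_sub_distrib,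
            ← Finset.sum_sub_distrib, ← Finset.sum_add_distrib]
          congr 1
          refine Finset.sum_congr rfl fun z _ => ?_
          rw [← unitary_mulVec_dotProduct (G.conn x y) (G.diff y z f) (G.diff y z g)]
          simp only [diff₂, star_sub, sub_dotProduct, dotProduct_sub]
          ring
        have h6 : ∑ y ∈ G.nbrs x, (G.p x y : ℂ) * (G.rate x *
              (G.diff x y f ⬝ᵥ star (G.diff x y g)))
            = G.rate x * ∑ y ∈ G.nbrs x, (G.p x y : ℂ) *
              (G.diff x y f ⬝ᵥ star (G.diff x y g)) := by
          rw [Finset.mul_sum]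
          exact Finset.sum_congr rfl fun y _ => by ring
        rw [h5, h6, h4]
        ring

/-! ### The Schur complement as a partial evaluation of `Γ₂^σ` -/

theorem mem_sphere_two (G : ConnectionGraph V d) {x z : V} :
    z ∈ G.sphere x 2 ↔ z ≠ x ∧ G.w x z = 0 ∧ ∃ y, G.w x y ≠ 0 ∧ G.w y z ≠ 0 := by
  change G.graph.edist x z = ((2 : ℕ) : ℕ∞) ↔ _
  constructor
  · intro hz
    refine ⟨?_, ?_, ?_⟩
    · rintro rfl
      simp at hz
    · by_contra h
      have : G.graph.edist x z = 1 := SimpleGraph.edist_eq_one_iff_adj.mpr h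
      rw [this] at hz
      norm_num at hz
    · obtain ⟨p, hp⟩ := SimpleGraph.exists_walk_of_edist_eq_coe hz
      cases p with
      | nil => simp at hp
      | cons h q =>
        cases q with
        | nil => simp at hp
        | cons h' r =>
          cases r with
          | nil => exact ⟨_, h, h'⟩
          | cons h'' s => simp at hp
  · rintro ⟨h0, h1, y, hy, hz⟩
    have hxy : G.graph.Adj x y := hy
    have hyz : G.graph.Adj y z := hz
    have hle : G.graph.edist x z ≤ ((2 : ℕ) : ℕ∞) :=
      SimpleGraph.edist_le (.cons hxy (.cons hyz .nil))
    have hne0 : G.graph.edist x z ≠ 0 := fun h => h0 (SimpleGraph.edist_eq_zero_iff.mp h).symm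
    have hne1 : G.graph.edist x z ≠ 1 := fun h => SimpleGraph.edist_eq_one_iff_adj.mp h h1
    have hfin : G.graph.edist x z ≠ ⊤ := fun h => by simp [h] at hle
    lift G.graph.edist x z to ℕ using hfin with k
    norm_cast at *
    omega

theorem mem_nbrs_trichotomy (G : ConnectionGraph V d) {x y z : V} (hy : y ∈ G.nbrs x)
    (hz : z ∈ G.nbrs y) : z = x ∨ z ∈ G.sphere x 1 ∨ z ∈ G.sphere x 2 := by
  rw [mem_nbrs] at hy hz
  rw [mem_sphere_one, mem_sphere_two]
  by_cases h : z = x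
  · exact .inl h
  · by_cases h' : G.w x z = 0
    · exact .inr (.inr ⟨h, h', y, hy, hz⟩)
    · exact .inr (.inl h')

/-! ### Sesquilinearity and locality of `Γ₂^σ` -/

theorem diff_add (G : ConnectionGraph V d) (x y : V) (f g : V → Fin d → ℂ) :
    G.diff x y (f + g) = G.diff x y f + G.diff x y g := by
  simp only [diff, Pi.add_apply, mulVec_add]
  abel

theorem diff_smul (G : ConnectionGraph V d) (x y : V) (c : ℂ) (f : V → Fin d → ℂ) :
    G.diff x y (c • f) = c • G.diff x y f := by
  simp only [diff, Pi.smul_apply, mulVec_smul, smul_sub]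

theorem diff₂_add (G : ConnectionGraph V d) (x y z : V) (f g : V → Fin d → ℂ) :
    G.diff₂ x y z (f + g) = G.diff₂ x y z f + G.diff₂ x y z g := by
  simp only [diff₂, diff_add, mulVec_add]
  abel

theorem diff₂_smul (G : ConnectionGraph V d) (x y z : V) (c : ℂ) (f : V → Fin d → ℂ) :
    G.diff₂ x y z (c • f) = c • G.diff₂ x y z f := by
  simp only [diff₂, diff_smul, mulVec_smul, smul_sub]

theorem connLap_add (G : ConnectionGraph V d) (f g : V → Fin d → ℂ) (x : V) :
    G.connLap (f + g) x = G.connLap f x + G.connLap g x := by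
  simp only [connLap_eq_sum_diff, diff_add, smul_add, Finset.sum_add_distrib]

theorem connLap_smul (G : ConnectionGraph V d) (c : ℂ) (f : V → Fin d → ℂ) (x : V) :
    G.connLap (c • f) x = c • G.connLap f x := by
  simp only [connLap_eq_sum_diff, diff_smul, Finset.smul_sum, smul_comm c]

theorem Gam2_add_left (G : ConnectionGraph V d) (f f' g : V → Fin d → ℂ) (x : V) :
    G.Gam2 (f + f') g x = G.Gam2 f g x + G.Gam2 f' g x := by
  refine mul_left_cancel₀ (four_ne_zero (α := ℂ)) ?_
  rw [mul_add, Gam2_eq, Gam2_eq, Gam2_eq]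
  simp only [diff_add, diff₂_add, connLap_add, add_dotProduct, mul_add, Finset.sum_add_distrib]
  ring

theorem Gam2_smul_left (G : ConnectionGraph V d) (c : ℂ) (f g : V → Fin d → ℂ) (x : V) :
    G.Gam2 (c • f) g x = c * G.Gam2 f g x := by
  refine mul_left_cancel₀ (four_ne_zero (α := ℂ)) ?_
  rw [mul_left_comm, Gam2_eq, Gam2_eq]
  simp only [diff_smul, diff₂_smul, connLap_smul, smul_dotProduct, smul_eq_mul,
    mul_left_comm _ c, ← Finset.mul_sum]
  ring

/-- Every term of `Gam2_eq` is Hermitian with real coefficients. This transfers statements about the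
first argument to the second. -/
theorem star_Gam2 (G : ConnectionGraph V d) (f g : V → Fin d → ℂ) (x : V) :
    star (G.Gam2 f g x) = G.Gam2 g f x := by
  have hs : ∀ u v : Fin d → ℂ, star (u ⬝ᵥ star v) = v ⬝ᵥ star u := fun u v =>
    (dotProduct_star v u).symm
  refine mul_left_cancel₀ (four_ne_zero (α := ℂ)) ?_
  have h4 : star (4 : ℂ) = 4 := by simp
  have h2 : star (2 : ℂ) = 2 := by simp
  have hr : ∀ y, star (G.rate y) = G.rate y := fun y => by
    simp [rate]
  have hp : ∀ r : ℝ, star (r : ℂ) = r := fun r => by simp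
  rw [Gam2_eq, ← h4, ← star_mul', Gam2_eq]
  simp only [star_add, star_sub, star_mul', star_sum, hs, hp, hr, h2]

theorem Gam2_zero_left (G : ConnectionGraph V d) (g : V → Fin d → ℂ) (x : V) :
    G.Gam2 0 g x = 0 := by
  simpa using G.Gam2_smul_left 0 0 g x

/-- `Γ₂^σ(f,g)(x)` depends only on the values of `f` on the ball of radius two. -/
theorem Gam2_congr_left (G : ConnectionGraph V d) {f f' : V → Fin d → ℂ} (g : V → Fin d → ℂ)
    {x : V} (h0 : f x = f' x) (h1 : ∀ y ∈ G.sphere x 1, f y = f' y)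
    (h2 : ∀ y ∈ G.sphere x 2, f y = f' y) : G.Gam2 f g x = G.Gam2 f' g x := by
  have hd : ∀ y ∈ G.nbrs x, G.diff x y f = G.diff x y f' := fun y hy => by
    rw [diff, diff, h0, h1 y (G.mem_sphere_one.mpr (G.mem_nbrs.mp hy))]
  have hL : G.connLap f x = G.connLap f' x :=
    Finset.sum_congr rfl fun y hy => congrArg _ (hd y hy)
  refine mul_left_cancel₀ (four_ne_zero (α := ℂ)) ?_
  rw [Gam2_eq, Gam2_eq, hL]
  refine congrArg₂ (· + ·) (congrArg₂ (· - ·) ?_ ?_) rfl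
  · refine Finset.sum_congr rfl fun y hy => congrArg _ (Finset.sum_congr rfl fun z hz => ?_)
    have hz' : f z = f' z := by
      rcases G.mem_nbrs_trichotomy hy hz with rfl | h | h
      exacts [h0, h1 z h, h2 z h]
    have hy' : f y = f' y := h1 y (G.mem_sphere_one.mpr (G.mem_nbrs.mp hy))
    have hdd : G.diff₂ x y z f = G.diff₂ x y z f' := by
      simp only [diff₂, hd y hy]
      simp only [diff, hz', hy']
    rw [hdd]
  · exact Finset.sum_congr rfl fun y hy => by rw [hd y hy]

theorem p_pos (G : ConnectionGraph V d) {x y : V} (h : G.w x y ≠ 0) : 0 < G.p x y :=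
  div_pos (lt_of_le_of_ne (G.w_nonneg _ _) (Ne.symm h)) (G.mu_pos x)

/-! ### The block of `Γ₂^σ` on `S₂(x)` -/

open Classical in
theorem basisFun_apply (u : V × Fin d) (v : V) :
    basisFun u v = if v = u.1 then Pi.single u.2 1 else 0 := by
  rw [basisFun, Pi.single_apply]

open Classical in
theorem diff₂_basisFun (G : ConnectionGraph V d) {x y z u : V} (i : Fin d) (hx : u ≠ x)
    (hy : y ≠ u) :
    G.diff₂ x y z (basisFun (u, i)) = if z = u then
      (G.conn x y : Matrix (Fin d) (Fin d) ℂ) *ᵥ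
        ((G.conn y z : Matrix (Fin d) (Fin d) ℂ) *ᵥ Pi.single i 1) else 0 := by
  rw [diff₂, diff, diff, basisFun_apply, basisFun_apply, basisFun_apply, if_neg hy,
    if_neg hx.symm]
  split_ifs <;> simp

/-- First differences at `x` do not see `S₂(x)`, so only the second-difference term of `Gam2_eq`
contributes to the `S₂` block. -/
theorem diff_basisFun_sphere_two (G : ConnectionGraph V d) {x y u : V} (i : Fin d)
    (hu : u ∈ G.sphere x 2) (hy : y ∈ G.nbrs x) : G.diff x y (basisFun (u, i)) = 0 := by
  obtain ⟨h0, h1, -⟩ := G.mem_sphere_two.mp hu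
  have hyu : y ≠ u := by
    rintro rfl
    exact G.mem_nbrs.mp hy h1
  rw [diff, basisFun_apply, basisFun_apply, if_neg hyu, if_neg (Ne.symm h0)]
  simp

/-- The diagonal entry `¼ ∑_y p_{xy} p_{yz}` of `Γ₂^σ(x)` at `z ∈ S₂(x)`. -/
def weight₂ (G : ConnectionGraph V d) (x z : V) : ℂ :=
  ((1 / 4 * ∑ y ∈ G.nbrs x, G.p x y * G.p y z : ℝ) : ℂ)

theorem weight₂_ne_zero (G : ConnectionGraph V d) {x z : V} (hz : z ∈ G.sphere x 2) :
    G.weight₂ x z ≠ 0 := by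
  obtain ⟨-, -, y, hy, hyz⟩ := G.mem_sphere_two.mp hz
  have : 0 < ∑ y ∈ G.nbrs x, G.p x y * G.p y z := by
    refine Finset.sum_pos' (fun u _ => ?_) ⟨y, G.mem_nbrs.mpr hy, mul_pos (G.p_pos hy)
      (G.p_pos hyz)⟩
    exact mul_nonneg (div_nonneg (G.w_nonneg _ _) (G.mu_pos _).le)
      (div_nonneg (G.w_nonneg _ _) (G.mu_pos _).le)
  rw [weight₂, Complex.ofReal_ne_zero]
  positivity

-- Along a path `x, y, z` the second difference of a basis function at `z` is a unitary image of a
-- standard basis vector. Orthonormality makes the block diagonal, and each two-step path to `z`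
-- adds its weight.
open Classical in
theorem Gam2_basisFun_sphere_two (G : ConnectionGraph V d) {x u v : V} (i j : Fin d)
    (hu : u ∈ G.sphere x 2) (hv : v ∈ G.sphere x 2) :
    G.Gam2 (basisFun (u, i)) (basisFun (v, j)) x
      = if u = v ∧ i = j then G.weight₂ x u else 0 := by
  have hL : G.connLap (basisFun (u, i)) x = 0 := by
    rw [connLap_eq_sum_diff]
    exact Finset.sum_eq_zero fun y hy => by rw [G.diff_basisFun_sphere_two i hu hy, smul_zero]
  have hD : ∑ y ∈ G.nbrs x, (G.p x y : ℂ) * ((G.rate x + G.rate y) *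
      (G.diff x y (basisFun (u, i)) ⬝ᵥ star (G.diff x y (basisFun (v, j))))) = 0 :=
    Finset.sum_eq_zero fun y hy => by
      rw [G.diff_basisFun_sphere_two i hu hy, zero_dotProduct, mul_zero, mul_zero]
  have hne : ∀ {y z}, y ∈ G.nbrs x → z ∈ G.sphere x 2 → y ≠ z := by
    rintro y z hy hz rfl
    exact G.mem_nbrs.mp hy (G.mem_sphere_two.mp hz).2.1
  have h4 : 4 * G.Gam2 (basisFun (u, i)) (basisFun (v, j)) x
      = ∑ y ∈ G.nbrs x, (G.p x y : ℂ) *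
        if u = v ∧ i = j then (G.p y u : ℂ) else 0 := by
    rw [Gam2_eq, hL, hD, zero_dotProduct, mul_zero, sub_zero, add_zero]
    refine Finset.sum_congr rfl fun y hy => congrArg _ ?_
    have hterm : ∀ z ∈ G.nbrs y, (G.p y z : ℂ) * (G.diff₂ x y z (basisFun (u, i)) ⬝ᵥ
        star (G.diff₂ x y z (basisFun (v, j))))
        = if z = u then (if u = v ∧ i = j then (G.p y u : ℂ) else 0) else 0 := by
      intro z _
      rw [G.diff₂_basisFun i (G.mem_sphere_two.mp hu).1 (hne hy hu),
        G.diff₂_basisFun j (G.mem_sphere_two.mp hv).1 (hne hy hv)]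
      by_cases h1 : z = u
      · subst h1
        by_cases h2 : z = v
        · subst h2
          rw [if_pos rfl, if_pos rfl, if_pos rfl, unitary_mulVec_dotProduct,
            unitary_mulVec_dotProduct]
          by_cases h3 : i = j
          · subst h3; simp
          · simp [h3, Ne.symm h3]
        · simp [h2]
      · simp [h1]
    rw [Finset.sum_congr rfl hterm, Finset.sum_ite_eq']
    split_ifs with h1 h2 h2
    · rfl
    · rfl
    -- If `u` is not a neighbour of `y`, the path is absent but its weight `p_{yu}` is zero anyway.
    · rw [mem_nbrs, not_not] at h1
      simp [p, h1]
    · rfl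
  refine mul_left_cancel₀ (four_ne_zero (α := ℂ)) ?_
  rw [h4, weight₂]
  split_ifs
  · push_cast
    ring
  · simp

open Classical in
theorem Gam2Matrix_sphere_two (G : ConnectionGraph V d) (x : V) :
    (G.Gam2Matrix x).submatrix (G.idxS2 x) (G.idxS2 x)
      = Matrix.diagonal fun q => G.weight₂ x q.1 := by
  ext ⟨u, i⟩ ⟨v, j⟩
  have := G.Gam2_basisFun_sphere_two i j u.2 v.2
  rw [Matrix.submatrix_apply, Gam2Matrix, Matrix.of_apply, idxS2, idxS2]
  rw [this, Matrix.diagonal_apply]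
  simp [Prod.ext_iff, Subtype.ext_iff]

-- Ensures that the `⁻¹` in `Q` is a genuine inverse and not the default value for singular
-- matrices.
open Classical in
theorem isUnit_Gam2Matrix_sphere_two (G : ConnectionGraph V d) (x : V) :
    IsUnit ((G.Gam2Matrix x).submatrix (G.idxS2 x) (G.idxS2 x)).det := by
  rw [Gam2Matrix_sphere_two, Matrix.det_diagonal, isUnit_iff_ne_zero]
  exact Finset.prod_ne_zero_iff.mpr fun q _ => G.weight₂_ne_zero q.1.2

/-- The vertices and coordinates of the ball of radius two. -/
def idxB2 (G : ConnectionGraph V d) (x : V) :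
    (Fin d ⊕ (G.sphere x 1 × Fin d)) ⊕ (G.sphere x 2 × Fin d) → V × Fin d :=
  Sum.elim (G.idxB1 x) (G.idxS2 x)

theorem idxB2_injective (G : ConnectionGraph V d) (x : V) : Function.Injective (G.idxB2 x) := by
  have h1 : ∀ y : G.sphere x 1, (y : V) ≠ x := fun y h =>
    G.mem_sphere_one.mp y.2 (by rw [h, G.w_self])
  have h2 : ∀ y : G.sphere x 2, (y : V) ≠ x := fun y => (G.mem_sphere_two.mp y.2).1
  have h3 : ∀ (y : G.sphere x 1) (z : G.sphere x 2), (y : V) ≠ z := fun y z h =>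
    G.mem_sphere_one.mp y.2 (by rw [h, (G.mem_sphere_two.mp z.2).2.1])
  rintro ((i | ⟨y, i⟩) | ⟨z, i⟩) ((j | ⟨y', j⟩) | ⟨z', j⟩) h <;>
    simp only [idxB2, idxB1, idxS2, Sum.elim_inl, Sum.elim_inr, Prod.mk.injEq] at h
  · rw [h.2]
  · exact absurd h.1.symm (h1 _)
  · exact absurd h.1.symm (h2 _)
  · exact absurd h.1 (h1 _)
  · rw [h.2, Subtype.ext h.1]
  · exact absurd h.1 (h3 _ _)
  · exact absurd h.1 (h2 _)
  · exact absurd h.1.symm (h3 _ _)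
  · rw [h.2, Subtype.ext h.1]

theorem mem_range_idxB2 (G : ConnectionGraph V d) {x v : V} (i : Fin d)
    (h : v = x ∨ v ∈ G.sphere x 1 ∨ v ∈ G.sphere x 2) : ∃ k, G.idxB2 x k = (v, i) := by
  rcases h with rfl | h | h
  · exact ⟨.inl (.inl i), rfl⟩
  · exact ⟨.inl (.inr (⟨v, h⟩, i)), rfl⟩
  · exact ⟨.inr (⟨v, h⟩, i), rfl⟩

/-! ### Expansion over the ball of radius two -/

theorem Gam2_sum_left {ι : Type*} (G : ConnectionGraph V d) (s : Finset ι) (c : ι → ℂ)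
    (φ : ι → V → Fin d → ℂ) (g : V → Fin d → ℂ) (x : V) :
    G.Gam2 (∑ k ∈ s, c k • φ k) g x = ∑ k ∈ s, c k * G.Gam2 (φ k) g x := by
  classical
  induction s using Finset.induction_on with
  | empty => simp [Gam2_zero_left]
  | insert k s hk ih =>
    rw [Finset.sum_insert hk, Finset.sum_insert hk, Gam2_add_left, Gam2_smul_left, ih]

/-- As `V` may be infinite, `f` need not be a finite combination of basis functions. Its truncation
to the ball of radius two is one, and locality shows that this suffices. -/
theorem Gam2_expand_left (G : ConnectionGraph V d) (f g : V → Fin d → ℂ) (x : V) :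
    G.Gam2 f g x = ∑ k, f (G.idxB2 x k).1 (G.idxB2 x k).2 *
      G.Gam2 (basisFun (G.idxB2 x k)) g x := by
  classical
  rw [← Gam2_sum_left]
  have key : ∀ v, (v = x ∨ v ∈ G.sphere x 1 ∨ v ∈ G.sphere x 2) →
      f v = (∑ k, f (G.idxB2 x k).1 (G.idxB2 x k).2 • basisFun (G.idxB2 x k)) v := by
    intro v hv
    funext i
    obtain ⟨k, hk⟩ := G.mem_range_idxB2 i hv
    rw [Finset.sum_apply, Finset.sum_apply, Finset.sum_eq_single k]
    · simp [hk, basisFun_apply]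
    · intro l _ hl
      have hne : ¬ (v = (G.idxB2 x l).1 ∧ i = (G.idxB2 x l).2) := fun h =>
        hl (G.idxB2_injective x (by rw [hk]; exact Prod.ext h.1.symm h.2.symm))
      rw [Pi.smul_apply, Pi.smul_apply, basisFun_apply]
      by_cases h1 : v = (G.idxB2 x l).1
      · rw [if_pos h1, Pi.single_eq_of_ne fun h2 => hne ⟨h1, h2⟩, smul_zero]
      · rw [if_neg h1, Pi.zero_apply, smul_zero]
    · simp
  exact G.Gam2_congr_left g (key x (.inl rfl)) (fun y hy => key y (.inr (.inl hy)))
    (fun y hy => key y (.inr (.inr hy)))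

theorem Gam2_expand_right (G : ConnectionGraph V d) (f g : V → Fin d → ℂ) (x : V) :
    G.Gam2 f g x = ∑ k, G.Gam2 f (basisFun (G.idxB2 x k)) x *
      star (g (G.idxB2 x k).1 (G.idxB2 x k).2) := by
  rw [← star_Gam2, Gam2_expand_left, star_sum]
  exact Finset.sum_congr rfl fun k _ => by rw [star_mul', star_Gam2, mul_comm]

/-- The values on the unit ball around `x`. -/
def valB1 (G : ConnectionGraph V d) (x : V) (f : V → Fin d → ℂ) :
    Fin d ⊕ (G.sphere x 1 × Fin d) → ℂ :=
  fun k => f (G.idxB1 x k).1 (G.idxB1 x k).2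

/-- The function `g` is `Γ₂^σ`-optimal at `x`: on `S₂(x)` it is the extension of its values on
`B₁(x)` that realises the Schur complement. -/
def IsOptimal (G : ConnectionGraph V d) (x : V) (g : V → Fin d → ℂ) : Prop :=
  ∀ (z : V) (i : Fin d), z ∈ G.sphere x 2 → G.Gam2 (basisFun (z, i)) g x = 0

/-- Optimality is the `S₂` row of the block system. Eliminating the `S₂` values of `g` turns the
`B₁` rows into `Q`. The `S₂` values of `f` are multiplied by zero, so `f` needs no optimality. -/
theorem valB1_dotProduct_Q (G : ConnectionGraph V d) {x : V} (f : V → Fin d → ℂ)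
    {g : V → Fin d → ℂ} (hg : G.IsOptimal x g) :
    G.valB1 x f ⬝ᵥ (G.Q x *ᵥ star (G.valB1 x g)) = G.Gam2 f g x := by
  classical
  set S := (G.Gam2Matrix x).submatrix (G.idxS2 x) (G.idxS2 x) with hS
  set T := (G.Gam2Matrix x).submatrix (G.idxS2 x) (G.idxB1 x) with hT
  let gS : G.sphere x 2 × Fin d → ℂ := fun q => star (g q.1 q.2)
  have hopt : T *ᵥ star (G.valB1 x g) + S *ᵥ gS = 0 := by
    funext q
    have := hg q.1 q.2 q.1.2
    rw [Gam2_expand_right, Fintype.sum_sum_type] at this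
    exact this
  have hsol : gS = -(S⁻¹ *ᵥ (T *ᵥ star (G.valB1 x g))) := by
    have h : S⁻¹ *ᵥ (S *ᵥ gS) = gS := by
      rw [Matrix.mulVec_mulVec, Matrix.nonsing_inv_mul _ (G.isUnit_Gam2Matrix_sphere_two x),
        Matrix.one_mulVec]
    rw [← h, ← Matrix.mulVec_neg, ← eq_neg_of_add_eq_zero_right hopt]
  have hrow : ∀ k, (G.Q x *ᵥ star (G.valB1 x g)) k
      = G.Gam2 (basisFun (G.idxB1 x k)) g x := by
    intro k
    rw [Gam2_expand_right, Fintype.sum_sum_type]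
    change _ = ((G.Gam2Matrix x).submatrix (G.idxB1 x) (G.idxB1 x) *ᵥ star (G.valB1 x g)) k
      + ((G.Gam2Matrix x).submatrix (G.idxB1 x) (G.idxS2 x) *ᵥ gS) k
    rw [Q, ← hS, ← hT, Matrix.sub_mulVec, hsol, Matrix.mulVec_neg, Matrix.mulVec_mulVec,
      Matrix.mulVec_mulVec, Matrix.mul_assoc, Pi.sub_apply, Pi.neg_apply, sub_eq_add_neg]
  rw [Gam2_expand_left, Fintype.sum_sum_type]
  have hz : ∑ q, f (G.idxB2 x (.inr q)).1 (G.idxB2 x (.inr q)).2 *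
      G.Gam2 (basisFun (G.idxB2 x (.inr q))) g x = 0 :=
    Finset.sum_eq_zero fun q _ => by
      rw [show G.Gam2 (basisFun (G.idxB2 x (.inr q))) g x = 0 from hg q.1 q.2 q.1.2, mul_zero]
  rw [hz, add_zero, dotProduct]
  exact Finset.sum_congr rfl fun k _ => congrArg _ (hrow k)

theorem exists_isOptimal (G : ConnectionGraph V d) (x : V)
    (b : Fin d ⊕ (G.sphere x 1 × Fin d) → ℂ) : ∃ g, G.valB1 x g = b ∧ G.IsOptimal x g := by
  classical
  set S := (G.Gam2Matrix x).submatrix (G.idxS2 x) (G.idxS2 x) with hS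
  set T := (G.Gam2Matrix x).submatrix (G.idxS2 x) (G.idxB1 x) with hT
  -- The system is linear in the conjugate of `g`, so its solution on `S₂(x)` has to be conjugated
  -- back.
  let e := Sum.elim b (star (-(S⁻¹ *ᵥ (T *ᵥ star b))))
  -- The default value `0` outside the ball of radius two plays no role, by locality.
  obtain ⟨F, hF⟩ : ∃ F : V × Fin d → ℂ, ∀ k, F (G.idxB2 x k) = e k :=
    ⟨Function.extend (G.idxB2 x) e 0, fun k => (G.idxB2_injective x).extend_apply e 0 k⟩
  refine ⟨fun v i => F (v, i), funext fun k => hF (.inl k), fun z i hz => ?_⟩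
  rw [Gam2_expand_right, Fintype.sum_sum_type]
  have hsum : T *ᵥ star b + S *ᵥ (-(S⁻¹ *ᵥ (T *ᵥ star b))) = 0 := by
    rw [Matrix.mulVec_neg, Matrix.mulVec_mulVec,
      Matrix.mul_nonsing_inv _ (G.isUnit_Gam2Matrix_sphere_two x), Matrix.one_mulVec,
      add_neg_cancel]
  refine Eq.trans ?_ (congrFun hsum (⟨z, hz⟩, i))
  rw [Pi.add_apply]
  congr 1
  · exact Finset.sum_congr rfl fun k _ => congrArg (_ * star ·) (hF (.inl k))
  · refine Finset.sum_congr rfl fun q _ => ?_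
    refine (congrArg (_ * star ·) (hF (.inr q))).trans ?_
    simp only [e, Sum.elim_inr, Pi.star_apply, star_star]
    rfl

/-! ### `Γ₂^σ` on Cartesian products -/

section Product

variable (α β : ℝ) (hα : 0 < α) (hβ : 0 < β) (G : ConnectionGraph V d)
  (G' : ConnectionGraph V' d)

local notation "𝒫" => ConnectionGraph.prod α β hα hβ G G'

theorem ne_of_mem_nbrs {G : ConnectionGraph V d} {x y : V} (h : y ∈ G.nbrs x) : x ≠ y := by
  rintro rfl
  exact G.mem_nbrs.mp h (G.w_self x)

theorem prod_p_left (x y : V) (x' : V') :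
    (𝒫).p (x, x') (y, x') = α * G.p x y := by
  have h := (G'.mu_pos x').ne'
  have h' := (G.mu_pos x).ne'
  simp only [p, prod, if_true]
  field_simp

/-- The definition of `prod` tests the second coordinates first, so for edges of the second factor
`x' ≠ y'` must be known. -/
theorem prod_p_right (x : V) {x' y' : V'} (h : x' ≠ y') :
    (𝒫).p (x, x') (x, y') = β * G'.p x' y' := by
  have h1 := (G'.mu_pos x').ne'
  have h2 := (G.mu_pos x).ne'
  simp only [p, prod, if_true, if_neg h]
  field_simp

theorem prod_conn_left (x y : V) (x' : V') : (𝒫).conn (x, x') (y, x') = G.conn x y := by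
  simp [prod]

theorem prod_conn_right (x : V) {x' y' : V'} (h : x' ≠ y') :
    (𝒫).conn (x, x') (x, y') = G'.conn x' y' := by
  simp [prod, h]

theorem prod_w_left (x y : V) (x' : V') : (𝒫).w (x, x') (y, x') ≠ 0 ↔ G.w x y ≠ 0 := by
  simp [prod, hα.ne', (G'.mu_pos x').ne']

theorem prod_w_right (x : V) {x' y' : V'} (h : x' ≠ y') :
    (𝒫).w (x, x') (x, y') ≠ 0 ↔ G'.w x' y' ≠ 0 := by
  simp [prod, h, hβ.ne', (G.mu_pos x).ne']

theorem prod_w_eq_zero {x y : V} {x' y' : V'} (h : x ≠ y) (h' : x' ≠ y') :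
    (𝒫).w (x, x') (y, y') = 0 := by
  simp [prod, h, h']

theorem sum_nbrs_prod {M : Type*} [AddCommMonoid M] (x : V) (x' : V') (F : V × V' → M) :
    ∑ u ∈ (𝒫).nbrs (x, x'), F u
      = ∑ y ∈ G.nbrs x, F (y, x') + ∑ y' ∈ G'.nbrs x', F (x, y') := by
  classical
  have h : (𝒫).nbrs (x, x') = (G.nbrs x).image (fun y => (y, x')) ∪
      (G'.nbrs x').image (fun y' => (x, y')) := by
    ext ⟨y, y'⟩
    rw [Finset.mem_union, Finset.mem_image, Finset.mem_image, mem_nbrs]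
    constructor
    · intro h
      by_cases h2 : x' = y'
      · subst h2
        exact .inl ⟨y, G.mem_nbrs.mpr ((prod_w_left α β hα hβ G G' x y x').mp h), rfl⟩
      · by_cases h1 : x = y
        · subst h1
          exact .inr ⟨y', G'.mem_nbrs.mpr ((prod_w_right α β hα hβ G G' x h2).mp h), rfl⟩
        · exact absurd (prod_w_eq_zero α β hα hβ G G' h1 h2) h
    · rintro (⟨z, hz, h⟩ | ⟨z', hz', h⟩)
      · cases h
        exact (prod_w_left α β hα hβ G G' x _ x').mpr (G.mem_nbrs.mp hz)
      · cases h
        exact (prod_w_right α β hα hβ G G' _ (ne_of_mem_nbrs hz')).mpr (G'.mem_nbrs.mp hz')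
  rw [h, Finset.sum_union, Finset.sum_image, Finset.sum_image]
  · intro _ _ _ _ h
    exact congrArg Prod.snd h
  · intro _ _ _ _ h
    exact congrArg Prod.fst h
  · rw [Finset.disjoint_left]
    rintro _ h1 h2
    obtain ⟨y, hy, rfl⟩ := Finset.mem_image.mp h1
    obtain ⟨y', hy', h⟩ := Finset.mem_image.mp h2
    exact ne_of_mem_nbrs hy (congrArg Prod.fst h)

/-- Sums against the transition rates of the product split into the two factors. -/
theorem sum_nbrs_prod_p {M : Type*} [AddCommGroup M] [Module ℂ M] (x : V) (x' : V')
    (F : V × V' → M) :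
    ∑ u ∈ (𝒫).nbrs (x, x'), ((𝒫).p (x, x') u : ℂ) • F u
      = (α : ℂ) • ∑ y ∈ G.nbrs x, (G.p x y : ℂ) • F (y, x')
        + (β : ℂ) • ∑ y' ∈ G'.nbrs x', (G'.p x' y' : ℂ) • F (x, y') := by
  rw [sum_nbrs_prod, Finset.smul_sum, Finset.smul_sum]
  congr 1
  · refine Finset.sum_congr rfl fun y _ => ?_
    rw [prod_p_left, Complex.ofReal_mul, mul_smul]
  · refine Finset.sum_congr rfl fun y' hy' => ?_
    rw [prod_p_right _ _ _ _ _ _ _ (ne_of_mem_nbrs hy'), Complex.ofReal_mul, mul_smul]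

theorem prod_rate (x : V) (x' : V') :
    (𝒫).rate (x, x') = α * G.rate x + β * G'.rate x' := by
  have := sum_nbrs_prod_p α β hα hβ G G' x x' fun _ => (1 : ℂ)
  simpa only [smul_eq_mul, mul_one, rate] using this

theorem prod_diff_left (x y : V) (x' : V') (f : V × V' → Fin d → ℂ) :
    (𝒫).diff (x, x') (y, x') f = G.diff x y fun v => f (v, x') := by
  rw [diff, prod_conn_left, diff]

theorem prod_diff_right (x : V) {x' y' : V'} (h : x' ≠ y') (f : V × V' → Fin d → ℂ) :
    (𝒫).diff (x, x') (x, y') f = G'.diff x' y' fun v' => f (x, v') := by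
  rw [diff, prod_conn_right _ _ _ _ _ _ _ h, diff]

theorem prod_connLap (x : V) (x' : V') (f : V × V' → Fin d → ℂ) :
    (𝒫).connLap f (x, x') = (α : ℂ) • G.connLap (fun v => f (v, x')) x
      + (β : ℂ) • G'.connLap (fun v' => f (x, v')) x' := by
  rw [connLap_eq_sum_diff, sum_nbrs_prod_p, connLap_eq_sum_diff, connLap_eq_sum_diff]
  refine congrArg₂ (fun u v => (α : ℂ) • u + (β : ℂ) • v) ?_ ?_
  · exact Finset.sum_congr rfl fun y _ => by rw [prod_diff_left]
  · exact Finset.sum_congr rfl fun y' hy' => by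
      rw [prod_diff_right _ _ _ _ _ _ _ (ne_of_mem_nbrs hy')]

/-- The mixed second difference
`σ_{xy} σ'_{x'y'} f(y,y') - σ_{xy} f(y,x') - σ'_{x'y'} f(x,y') + f(x,x')`. -/
def mixedDiff (x y : V) (x' y' : V') (f : V × V' → Fin d → ℂ) : Fin d → ℂ :=
  (G.conn x y : Matrix (Fin d) (Fin d) ℂ) *ᵥ
      (G'.conn x' y' : Matrix (Fin d) (Fin d) ℂ) *ᵥ f (y, y')
    - (G.conn x y : Matrix (Fin d) (Fin d) ℂ) *ᵥ f (y, x')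
    - (G'.conn x' y' : Matrix (Fin d) (Fin d) ℂ) *ᵥ f (x, y') + f (x, x')

theorem conn_mem_signatureGroup {G : ConnectionGraph V d} {x y : V} (h : y ∈ G.nbrs x) :
    G.conn x y ∈ G.signatureGroup :=
  Subgroup.subset_closure ⟨x, y, G.mem_nbrs.mp h, rfl⟩

variable {G G'}

/-- The only point at which commutativity of the signature groups enters. -/
theorem conn_mulVec_comm
    (hcomm : ∀ g ∈ G.signatureGroup, ∀ g' ∈ G'.signatureGroup, g * g' = g' * g)
    {x y : V} {x' y' : V'} (hy : y ∈ G.nbrs x) (hy' : y' ∈ G'.nbrs x') (v : Fin d → ℂ) :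
    (G'.conn x' y' : Matrix (Fin d) (Fin d) ℂ) *ᵥ (G.conn x y : Matrix (Fin d) (Fin d) ℂ) *ᵥ v
      = (G.conn x y : Matrix (Fin d) (Fin d) ℂ) *ᵥ
        (G'.conn x' y' : Matrix (Fin d) (Fin d) ℂ) *ᵥ v := by
  have h := congrArg (Subtype.val) (hcomm _ (conn_mem_signatureGroup hy) _
    (conn_mem_signatureGroup hy'))
  rw [Matrix.mulVec_mulVec, Matrix.mulVec_mulVec]
  exact congrArg (· *ᵥ v) h.symm

/-- With `M` the mixed difference and `D`, `D'` the first differences in the two factors, the two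
ways round the square have second differences `M - D + D'` and `M + D - D'`. The parallelogram law
then gives the sum. -/
theorem prod_mixed_term
    (hcomm : ∀ g ∈ G.signatureGroup, ∀ g' ∈ G'.signatureGroup, g * g' = g' * g)
    {x y : V} {x' y' : V'} (hy : y ∈ G.nbrs x) (hy' : y' ∈ G'.nbrs x')
    (f g : V × V' → Fin d → ℂ) :
    (𝒫).diff₂ (x, x') (y, x') (y, y') f ⬝ᵥ star ((𝒫).diff₂ (x, x') (y, x') (y, y') g)
      + (𝒫).diff₂ (x, x') (x, y') (y, y') f ⬝ᵥ star ((𝒫).diff₂ (x, x') (x, y') (y, y') g)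
      = 2 * (mixedDiff G G' x y x' y' f ⬝ᵥ star (mixedDiff G G' x y x' y' g))
        + 2 * (G.diff x y (fun v => f (v, x')) ⬝ᵥ star (G.diff x y fun v => g (v, x')))
        + 2 * (G'.diff x' y' (fun v' => f (x, v')) ⬝ᵥ star (G'.diff x' y' fun v' => g (x, v')))
        - 2 * (G.diff x y (fun v => f (v, x')) ⬝ᵥ star (G'.diff x' y' fun v' => g (x, v')))
        - 2 * (G'.diff x' y' (fun v' => f (x, v')) ⬝ᵥ star (G.diff x y fun v => g (v, x'))) := by
  have h1 : ∀ f, (𝒫).diff₂ (x, x') (y, x') (y, y') f = mixedDiff G G' x y x' y' f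
      - G.diff x y (fun v => f (v, x')) + G'.diff x' y' (fun v' => f (x, v')) := by
    intro f
    rw [diff₂, prod_diff_left, prod_diff_right _ _ _ _ _ _ _ (ne_of_mem_nbrs hy'),
      prod_conn_left]
    simp only [diff, mixedDiff, mulVec_sub]
    abel
  have h2 : ∀ f, (𝒫).diff₂ (x, x') (x, y') (y, y') f = mixedDiff G G' x y x' y' f
      + G.diff x y (fun v => f (v, x')) - G'.diff x' y' (fun v' => f (x, v')) := by
    intro f
    rw [diff₂, prod_diff_left, prod_diff_right _ _ _ _ _ _ _ (ne_of_mem_nbrs hy'),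
      prod_conn_right _ _ _ _ _ _ _ (ne_of_mem_nbrs hy')]
    simp only [diff, mixedDiff, mulVec_sub, conn_mulVec_comm hcomm hy hy']
    abel
  simp only [h1, h2, star_add, star_sub, add_dotProduct, sub_dotProduct, dotProduct_add,
    dotProduct_sub]
  ring

theorem prod_diff₂_left (x y z : V) (x' : V') (f : V × V' → Fin d → ℂ) :
    (𝒫).diff₂ (x, x') (y, x') (z, x') f = G.diff₂ x y z fun v => f (v, x') := by
  rw [diff₂, prod_diff_left, prod_diff_left, prod_conn_left, diff₂]

theorem prod_diff₂_right (x : V) {x' y' z' : V'} (h : x' ≠ y') (h' : y' ≠ z')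
    (f : V × V' → Fin d → ℂ) :
    (𝒫).diff₂ (x, x') (x, y') (x, z') f = G'.diff₂ x' y' z' fun v' => f (x, v') := by
  rw [diff₂, prod_diff_right _ _ _ _ _ _ _ h, prod_diff_right _ _ _ _ _ _ _ h',
    prod_conn_right _ _ _ _ _ _ _ h, diff₂]

/-- Of the products in `prod_mixed_term`, the squares of `D` and `D'` cancel against the rate terms
and the products of `D` with `D'` against the cross terms of `2 Δ^σ f ⬝ conj Δ^σ g`. Only the mixed
differences survive. -/
theorem prod_Gam2
    (hcomm : ∀ g ∈ G.signatureGroup, ∀ g' ∈ G'.signatureGroup, g * g' = g' * g)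
    (x : V) (x' : V') (f g : V × V' → Fin d → ℂ) :
    (𝒫).Gam2 f g (x, x')
      = (α : ℂ) ^ 2 * G.Gam2 (fun v => f (v, x')) (fun v => g (v, x')) x
        + (β : ℂ) ^ 2 * G'.Gam2 (fun v' => f (x, v')) (fun v' => g (x, v')) x'
        + α * β / 2 * ∑ y ∈ G.nbrs x, ∑ y' ∈ G'.nbrs x', (G.p x y : ℂ) * (G'.p x' y' : ℂ) *
          (mixedDiff G G' x y x' y' f ⬝ᵥ star (mixedDiff G G' x y x' y' g)) := by
  set f₁ := fun v => f (v, x')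
  set g₁ := fun v => g (v, x')
  set f₂ := fun v' => f (x, v')
  set g₂ := fun v' => g (x, v')
  have hsmul := fun (x : V) (x' : V') (F : V × V' → ℂ) => sum_nbrs_prod_p α β hα hβ G G' x x' F
  simp only [smul_eq_mul] at hsmul
  have e1 : ∑ u ∈ (𝒫).nbrs (x, x'), ((𝒫).p (x, x') u : ℂ) * ∑ v ∈ (𝒫).nbrs u, ((𝒫).p u v : ℂ) *
          ((𝒫).diff₂ (x, x') u v f ⬝ᵥ star ((𝒫).diff₂ (x, x') u v g))
      = (α : ℂ) ^ 2 * ∑ y ∈ G.nbrs x, (G.p x y : ℂ) * ∑ z ∈ G.nbrs y, (G.p y z : ℂ) *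
          (G.diff₂ x y z f₁ ⬝ᵥ star (G.diff₂ x y z g₁))
        + (β : ℂ) ^ 2 * ∑ y' ∈ G'.nbrs x', (G'.p x' y' : ℂ) * ∑ z' ∈ G'.nbrs y',
          (G'.p y' z' : ℂ) * (G'.diff₂ x' y' z' f₂ ⬝ᵥ star (G'.diff₂ x' y' z' g₂))
        + α * β * ∑ y ∈ G.nbrs x, ∑ y' ∈ G'.nbrs x', (G.p x y : ℂ) * (G'.p x' y' : ℂ) *
          ((𝒫).diff₂ (x, x') (y, x') (y, y') f ⬝ᵥ star ((𝒫).diff₂ (x, x') (y, x') (y, y') g)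
          + (𝒫).diff₂ (x, x') (x, y') (y, y') f ⬝ᵥ
            star ((𝒫).diff₂ (x, x') (x, y') (y, y') g)) := by
    rw [hsmul]
    simp only [hsmul, mul_add, Finset.sum_add_distrib, prod_diff₂_left]
    have s1 : ∑ y' ∈ G'.nbrs x', (G'.p x' y' : ℂ) * ((β : ℂ) * ∑ z' ∈ G'.nbrs y',
          (G'.p y' z' : ℂ) * ((𝒫).diff₂ (x, x') (x, y') (x, z') f ⬝ᵥ
            star ((𝒫).diff₂ (x, x') (x, y') (x, z') g)))
        = β * ∑ y' ∈ G'.nbrs x', (G'.p x' y' : ℂ) * ∑ z' ∈ G'.nbrs y',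
          (G'.p y' z' : ℂ) * (G'.diff₂ x' y' z' f₂ ⬝ᵥ star (G'.diff₂ x' y' z' g₂)) := by
      rw [Finset.mul_sum]
      refine Finset.sum_congr rfl fun y' hy' => ?_
      rw [mul_left_comm]
      congr 2
      refine Finset.sum_congr rfl fun z' hz' => ?_
      rw [prod_diff₂_right _ _ _ _ _ (ne_of_mem_nbrs hy') (ne_of_mem_nbrs hz'),
        prod_diff₂_right _ _ _ _ _ (ne_of_mem_nbrs hy') (ne_of_mem_nbrs hz')]
    have s2 : ∑ y' ∈ G'.nbrs x', (G'.p x' y' : ℂ) * ((α : ℂ) * ∑ z ∈ G.nbrs x,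
          (G.p x z : ℂ) * ((𝒫).diff₂ (x, x') (x, y') (z, y') f ⬝ᵥ
            star ((𝒫).diff₂ (x, x') (x, y') (z, y') g)))
        = α * ∑ y ∈ G.nbrs x, ∑ y' ∈ G'.nbrs x', (G.p x y : ℂ) * (G'.p x' y' : ℂ) *
          ((𝒫).diff₂ (x, x') (x, y') (y, y') f ⬝ᵥ
            star ((𝒫).diff₂ (x, x') (x, y') (y, y') g)) := by
      rw [Finset.sum_comm, Finset.mul_sum]
      refine Finset.sum_congr rfl fun y' _ => ?_
      rw [mul_left_comm, Finset.mul_sum]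
      congr 1
      exact Finset.sum_congr rfl fun z _ => by ring
    have s3 : ∑ y ∈ G.nbrs x, (G.p x y : ℂ) * ((β : ℂ) * ∑ z' ∈ G'.nbrs x',
          (G'.p x' z' : ℂ) * ((𝒫).diff₂ (x, x') (y, x') (y, z') f ⬝ᵥ
            star ((𝒫).diff₂ (x, x') (y, x') (y, z') g)))
        = β * ∑ y ∈ G.nbrs x, ∑ y' ∈ G'.nbrs x', (G.p x y : ℂ) * (G'.p x' y' : ℂ) *
          ((𝒫).diff₂ (x, x') (y, x') (y, y') f ⬝ᵥ
            star ((𝒫).diff₂ (x, x') (y, x') (y, y') g)) := by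
      rw [Finset.mul_sum]
      refine Finset.sum_congr rfl fun y _ => ?_
      rw [mul_left_comm, Finset.mul_sum]
      congr 1
      exact Finset.sum_congr rfl fun z _ => by ring
    have s4 : ∑ y ∈ G.nbrs x, (G.p x y : ℂ) * ((α : ℂ) * ∑ z ∈ G.nbrs y, (G.p y z : ℂ) *
          (G.diff₂ x y z f₁ ⬝ᵥ star (G.diff₂ x y z g₁)))
        = α * ∑ y ∈ G.nbrs x, (G.p x y : ℂ) * ∑ z ∈ G.nbrs y, (G.p y z : ℂ) *
          (G.diff₂ x y z f₁ ⬝ᵥ star (G.diff₂ x y z g₁)) := by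
      rw [Finset.mul_sum]
      exact Finset.sum_congr rfl fun y _ => mul_left_comm _ _ _
    rw [s1, s2, s3, s4]
    ring
  -- An edge within one factor leaves the rate of the other factor unchanged. That rate is therefore
  -- counted at both endpoints, whence the factors `2`.
  have e2 : ∑ u ∈ (𝒫).nbrs (x, x'), ((𝒫).p (x, x') u : ℂ) * (((𝒫).rate (x, x') + (𝒫).rate u) *
          ((𝒫).diff (x, x') u f ⬝ᵥ star ((𝒫).diff (x, x') u g)))
      = (α : ℂ) ^ 2 * ∑ y ∈ G.nbrs x, (G.p x y : ℂ) * ((G.rate x + G.rate y) *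
          (G.diff x y f₁ ⬝ᵥ star (G.diff x y g₁)))
        + (β : ℂ) ^ 2 * ∑ y' ∈ G'.nbrs x', (G'.p x' y' : ℂ) * ((G'.rate x' + G'.rate y') *
          (G'.diff x' y' f₂ ⬝ᵥ star (G'.diff x' y' g₂)))
        + α * β * ∑ y ∈ G.nbrs x, ∑ y' ∈ G'.nbrs x', (G.p x y : ℂ) * (G'.p x' y' : ℂ) *
          (2 * (G.diff x y f₁ ⬝ᵥ star (G.diff x y g₁))
            + 2 * (G'.diff x' y' f₂ ⬝ᵥ star (G'.diff x' y' g₂))) := by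
    have t1 : ∑ y ∈ G.nbrs x, ∑ y' ∈ G'.nbrs x', (G.p x y : ℂ) * (G'.p x' y' : ℂ) *
          (2 * (G.diff x y f₁ ⬝ᵥ star (G.diff x y g₁)))
        = ∑ y ∈ G.nbrs x, (G.p x y : ℂ) * (2 * G'.rate x' *
          (G.diff x y f₁ ⬝ᵥ star (G.diff x y g₁))) := by
      refine Finset.sum_congr rfl fun y _ => ?_
      rw [← Finset.sum_mul, ← Finset.mul_sum, ← rate]
      ring
    have t2 : ∑ y ∈ G.nbrs x, ∑ y' ∈ G'.nbrs x', (G.p x y : ℂ) * (G'.p x' y' : ℂ) *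
          (2 * (G'.diff x' y' f₂ ⬝ᵥ star (G'.diff x' y' g₂)))
        = ∑ y' ∈ G'.nbrs x', (G'.p x' y' : ℂ) * (2 * G.rate x *
          (G'.diff x' y' f₂ ⬝ᵥ star (G'.diff x' y' g₂))) := by
      rw [Finset.sum_comm]
      refine Finset.sum_congr rfl fun y' _ => ?_
      rw [← Finset.sum_mul, ← Finset.sum_mul, ← rate]
      ring
    rw [hsmul]
    simp only [mul_add (_ * _ : ℂ) (2 * _ : ℂ), Finset.sum_add_distrib, t1, t2, prod_rate,
      prod_diff_left]
    have t3 : ∑ y' ∈ G'.nbrs x', (G'.p x' y' : ℂ) * ((α * G.rate x + β * G'.rate x'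
          + (α * G.rate x + β * G'.rate y')) *
          ((𝒫).diff (x, x') (x, y') f ⬝ᵥ star ((𝒫).diff (x, x') (x, y') g)))
        = β * ∑ y' ∈ G'.nbrs x', (G'.p x' y' : ℂ) * ((G'.rate x' + G'.rate y') *
          (G'.diff x' y' f₂ ⬝ᵥ star (G'.diff x' y' g₂)))
          + α * ∑ y' ∈ G'.nbrs x', (G'.p x' y' : ℂ) * (2 * G.rate x *
          (G'.diff x' y' f₂ ⬝ᵥ star (G'.diff x' y' g₂))) := by
      rw [Finset.mul_sum, Finset.mul_sum, ← Finset.sum_add_distrib]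
      refine Finset.sum_congr rfl fun y' hy' => ?_
      rw [prod_diff_right _ _ _ _ _ _ _ (ne_of_mem_nbrs hy'),
        prod_diff_right _ _ _ _ _ _ _ (ne_of_mem_nbrs hy')]
      ring
    have t4 : ∑ y ∈ G.nbrs x, (G.p x y : ℂ) * ((α * G.rate x + β * G'.rate x'
          + (α * G.rate y + β * G'.rate x')) *
          (G.diff x y f₁ ⬝ᵥ star (G.diff x y g₁)))
        = α * ∑ y ∈ G.nbrs x, (G.p x y : ℂ) * ((G.rate x + G.rate y) *
          (G.diff x y f₁ ⬝ᵥ star (G.diff x y g₁)))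
          + β * ∑ y ∈ G.nbrs x, (G.p x y : ℂ) * (2 * G'.rate x' *
          (G.diff x y f₁ ⬝ᵥ star (G.diff x y g₁))) := by
      rw [Finset.mul_sum, Finset.mul_sum, ← Finset.sum_add_distrib]
      exact Finset.sum_congr rfl fun y _ => by ring
    rw [t3, t4]
    ring
  have e3 : (𝒫).connLap f (x, x') ⬝ᵥ star ((𝒫).connLap g (x, x'))
      = (α : ℂ) ^ 2 * (G.connLap f₁ x ⬝ᵥ star (G.connLap g₁ x))
        + (β : ℂ) ^ 2 * (G'.connLap f₂ x' ⬝ᵥ star (G'.connLap g₂ x'))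
        + α * β * ∑ y ∈ G.nbrs x, ∑ y' ∈ G'.nbrs x', (G.p x y : ℂ) * (G'.p x' y' : ℂ) *
          (G.diff x y f₁ ⬝ᵥ star (G'.diff x' y' g₂)
            + G'.diff x' y' f₂ ⬝ᵥ star (G.diff x y g₁)) := by
    have m1 : G.connLap f₁ x ⬝ᵥ star (G'.connLap g₂ x')
        = ∑ y ∈ G.nbrs x, ∑ y' ∈ G'.nbrs x', (G.p x y : ℂ) * (G'.p x' y' : ℂ) *
          (G.diff x y f₁ ⬝ᵥ star (G'.diff x' y' g₂)) := by
      rw [connLap_dotProduct]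
      refine Finset.sum_congr rfl fun y _ => ?_
      rw [dotProduct_star_connLap, Finset.mul_sum]
      exact Finset.sum_congr rfl fun y' _ => by ring
    have m2 : G'.connLap f₂ x' ⬝ᵥ star (G.connLap g₁ x)
        = ∑ y ∈ G.nbrs x, ∑ y' ∈ G'.nbrs x', (G.p x y : ℂ) * (G'.p x' y' : ℂ) *
          (G'.diff x' y' f₂ ⬝ᵥ star (G.diff x y g₁)) := by
      rw [dotProduct_star_connLap]
      refine Finset.sum_congr rfl fun y _ => ?_
      rw [connLap_dotProduct, Finset.mul_sum]
      exact Finset.sum_congr rfl fun y' _ => by ring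
    simp only [prod_connLap, star_add, star_ofReal_smul, add_dotProduct, dotProduct_add,
      smul_dotProduct, dotProduct_smul, smul_eq_mul, mul_add, Finset.sum_add_distrib]
    rw [← m1, ← m2]
    ring
  have e4 : ∑ y ∈ G.nbrs x, ∑ y' ∈ G'.nbrs x', (G.p x y : ℂ) * (G'.p x' y' : ℂ) *
          ((𝒫).diff₂ (x, x') (y, x') (y, y') f ⬝ᵥ star ((𝒫).diff₂ (x, x') (y, x') (y, y') g)
          + (𝒫).diff₂ (x, x') (x, y') (y, y') f ⬝ᵥ
            star ((𝒫).diff₂ (x, x') (x, y') (y, y') g))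
      = 2 * ∑ y ∈ G.nbrs x, ∑ y' ∈ G'.nbrs x', (G.p x y : ℂ) * (G'.p x' y' : ℂ) *
          (mixedDiff G G' x y x' y' f ⬝ᵥ star (mixedDiff G G' x y x' y' g))
        + ∑ y ∈ G.nbrs x, ∑ y' ∈ G'.nbrs x', (G.p x y : ℂ) * (G'.p x' y' : ℂ) *
          (2 * (G.diff x y f₁ ⬝ᵥ star (G.diff x y g₁))
            + 2 * (G'.diff x' y' f₂ ⬝ᵥ star (G'.diff x' y' g₂)))
        - 2 * ∑ y ∈ G.nbrs x, ∑ y' ∈ G'.nbrs x', (G.p x y : ℂ) * (G'.p x' y' : ℂ) *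
          (G.diff x y f₁ ⬝ᵥ star (G'.diff x' y' g₂)
            + G'.diff x' y' f₂ ⬝ᵥ star (G.diff x y g₁)) := by
    simp only [Finset.mul_sum, ← Finset.sum_add_distrib, ← Finset.sum_sub_distrib]
    refine Finset.sum_congr rfl fun y hy => Finset.sum_congr rfl fun y' hy' => ?_
    rw [prod_mixed_term α β hα hβ hcomm hy hy' f g]
    ring
  refine mul_left_cancel₀ (four_ne_zero (α := ℂ)) ?_
  have hG := G.Gam2_eq f₁ g₁ x
  have hG' := G'.Gam2_eq f₂ g₂ x'
  rw [Gam2_eq, e1, e2, e3, e4]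
  linear_combination (-(α : ℂ) ^ 2) * hG - (β : ℂ) ^ 2 * hG'

end Product

/-! ### The matrices of Cartesian products at `B₀` -/

section Product

variable (α β : ℝ) (hα : 0 < α) (hβ : 0 < β) (G : ConnectionGraph V d)
  (G' : ConnectionGraph V' d)

local notation "𝒫" => ConnectionGraph.prod α β hα hβ G G'

/-- A two-step path between distinct vertices of one slice cannot leave the slice, since it would
need an edge changing both coordinates. -/
theorem mem_sphere_two_of_prod_left {x z : V} {x' : V'}
    (h : (z, x') ∈ (𝒫).sphere (x, x') 2) : z ∈ G.sphere x 2 := by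
  obtain ⟨h0, h1, ⟨y, y'⟩, hy, hz⟩ := (𝒫).mem_sphere_two.mp h
  have hzx : z ≠ x := fun e => h0 (by rw [e])
  have hyx' : x' = y' := by
    by_contra hne
    by_cases hxy : x = y
    · subst hxy
      exact hz (prod_w_eq_zero α β hα hβ G G' (Ne.symm hzx) (Ne.symm hne))
    · exact hy (prod_w_eq_zero α β hα hβ G G' hxy hne)
  subst hyx'
  rw [mem_sphere_two]
  refine ⟨hzx, ?_, y, (prod_w_left α β hα hβ G G' _ _ _).mp hy,
    (prod_w_left α β hα hβ G G' _ _ _).mp hz⟩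
  by_contra hne
  exact (prod_w_left α β hα hβ G G' _ _ _).mpr hne h1

theorem mem_sphere_two_of_prod_right {x : V} {x' z' : V'}
    (h : (x, z') ∈ (𝒫).sphere (x, x') 2) : z' ∈ G'.sphere x' 2 := by
  obtain ⟨h0, h1, ⟨y, y'⟩, hy, hz⟩ := (𝒫).mem_sphere_two.mp h
  have hzx : z' ≠ x' := fun e => h0 (by rw [e])
  have hyx : x = y := by
    by_contra hne
    by_cases hxy : x' = y'
    · subst hxy
      exact hz (prod_w_eq_zero α β hα hβ G G' (Ne.symm hne) (Ne.symm hzx))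
    · exact hy (prod_w_eq_zero α β hα hβ G G' hne hxy)
  subst hyx
  rw [mem_sphere_two]
  have hy' : x' ≠ y' := by
    rintro rfl
    exact hy ((𝒫).w_self _)
  have hz' : y' ≠ z' := by
    rintro rfl
    exact hz ((𝒫).w_self _)
  refine ⟨hzx, ?_, y', (prod_w_right α β hα hβ G G' _ hy').mp hy,
    (prod_w_right α β hα hβ G G' _ hz').mp hz⟩
  by_contra hne
  exact (prod_w_right α β hα hβ G G' _ (Ne.symm hzx)).mpr hne h1

variable {G G'}

/-- A basis function at a vertex of `S₂(x,x')` restricts on each slice to a basis function on the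
sphere `S₂` of that factor or to zero. All three terms of `prod_Gam2` therefore vanish. -/
theorem isOptimal_prod
    (hcomm : ∀ g ∈ G.signatureGroup, ∀ g' ∈ G'.signatureGroup, g * g' = g' * g)
    {x : V} {x' : V'} {g : V × V' → Fin d → ℂ} (h₁ : G.IsOptimal x fun v => g (v, x'))
    (h₂ : G'.IsOptimal x' fun v' => g (x, v'))
    (h : ∀ y ∈ G.nbrs x, ∀ y' ∈ G'.nbrs x', mixedDiff G G' x y x' y' g = 0) :
    (𝒫).IsOptimal (x, x') g := by
  rintro ⟨z, z'⟩ i hz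
  rw [prod_Gam2 α β hα hβ hcomm]
  have e1 : G.Gam2 (fun v => basisFun ((z, z'), i) (v, x')) (fun v => g (v, x')) x = 0 := by
    by_cases hz' : z' = x'
    · subst hz'
      have : (fun v => basisFun ((z, z'), i) (v, z')) = basisFun (z, i) := by
        funext v
        rw [basisFun_apply, basisFun_apply]
        by_cases hv : v = z
        · rw [if_pos hv, if_pos (by rw [hv])]
        · rw [if_neg hv, if_neg fun e => hv (congrArg Prod.fst e)]
      rw [this]
      exact h₁ z i (mem_sphere_two_of_prod_left α β hα hβ G G' hz)
    · have : (fun v => basisFun ((z, z'), i) (v, x')) = 0 := by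
        funext v
        simp [basisFun_apply, Ne.symm hz']
      rw [this, Gam2_zero_left]
  have e2 : G'.Gam2 (fun v' => basisFun ((z, z'), i) (x, v')) (fun v' => g (x, v')) x' = 0 := by
    by_cases hzx : z = x
    · subst hzx
      have : (fun v' => basisFun ((z, z'), i) (z, v')) = basisFun (z', i) := by
        funext v
        rw [basisFun_apply, basisFun_apply]
        by_cases hv : v = z'
        · rw [if_pos hv, if_pos (by rw [hv])]
        · rw [if_neg hv, if_neg fun e => hv (congrArg Prod.snd e)]
      rw [this]
      exact h₂ z' i (mem_sphere_two_of_prod_right α β hα hβ G G' hz)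
    · have : (fun v' => basisFun ((z, z'), i) (x, v')) = 0 := by
        funext v
        simp [basisFun_apply, Ne.symm hzx]
      rw [this, Gam2_zero_left]
  rw [e1, e2, Finset.sum_eq_zero fun y hy => Finset.sum_eq_zero fun y' hy' => by
    rw [h y hy y' hy', star_zero, dotProduct_zero, mul_zero]]
  ring

variable (G G')

/-- The inclusion of the index set of `B₁(x)` into that of `B₁(x,x')`. -/
def inclLeft (x : V) (x' : V') :
    Fin d ⊕ (G.sphere x 1 × Fin d) → Fin d ⊕ ((𝒫).sphere (x, x') 1 × Fin d) :=
  Sum.map id fun q => prodIndex α β hα hβ G G' x x' (.inl q)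

/-- The inclusion of the index set of `B₁(x')` into that of `B₁(x,x')`. -/
def inclRight (x : V) (x' : V') :
    Fin d ⊕ (G'.sphere x' 1 × Fin d) → Fin d ⊕ ((𝒫).sphere (x, x') 1 × Fin d) :=
  Sum.map id fun q => prodIndex α β hα hβ G G' x x' (.inr q)

theorem valB1_prod_inclLeft (x : V) (x' : V') (f : V × V' → Fin d → ℂ) :
    (𝒫).valB1 (x, x') f ∘ inclLeft α β hα hβ G G' x x' = G.valB1 x fun v => f (v, x') := by
  funext k
  rcases k with i | ⟨y, i⟩ <;> rfl

theorem valB1_prod_inclRight (x : V) (x' : V') (f : V × V' → Fin d → ℂ) :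
    (𝒫).valB1 (x, x') f ∘ inclRight α β hα hβ G G' x x' = G'.valB1 x' fun v' => f (x, v') := by
  funext k
  rcases k with i | ⟨y, i⟩ <;> rfl

theorem eq_of_comp_incl (x : V) (x' : V')
    {b c : Fin d ⊕ ((𝒫).sphere (x, x') 1 × Fin d) → ℂ}
    (h₁ : b ∘ inclLeft α β hα hβ G G' x x' = c ∘ inclLeft α β hα hβ G G' x x')
    (h₂ : b ∘ inclRight α β hα hβ G G' x x' = c ∘ inclRight α β hα hβ G G' x x') : b = c := by
  funext k
  rcases k with i | q
  · exact congrFun h₁ (.inl i)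
  · obtain ⟨r, rfl⟩ := (prodIndex α β hα hβ G G' x x').surjective q
    rcases r with r | r
    · exact congrFun h₁ (.inr r)
    · exact congrFun h₂ (.inr r)

variable {G G'}

theorem conn_mulVec_inv (U : Matrix.unitaryGroup (Fin d) ℂ) (v : Fin d → ℂ) :
    (U : Matrix (Fin d) (Fin d) ℂ) *ᵥ ((U⁻¹ : Matrix.unitaryGroup (Fin d) ℂ) :
      Matrix (Fin d) (Fin d) ℂ) *ᵥ v = v := by
  rw [Matrix.mulVec_mulVec, ← Submonoid.coe_mul, mul_inv_cancel, Submonoid.coe_one,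
    Matrix.one_mulVec]

/-- The sesquilinear form of `Q` on a product splits into the forms of the factors. -/
theorem prod_Q_form
    (hcomm : ∀ g ∈ G.signatureGroup, ∀ g' ∈ G'.signatureGroup, g * g' = g' * g)
    (x : V) (x' : V') (b c : Fin d ⊕ ((𝒫).sphere (x, x') 1 × Fin d) → ℂ) :
    b ⬝ᵥ ((𝒫).Q (x, x') *ᵥ star c)
      = (α : ℂ) ^ 2 * ((b ∘ inclLeft α β hα hβ G G' x x') ⬝ᵥ
          (G.Q x *ᵥ star (c ∘ inclLeft α β hα hβ G G' x x')))
        + (β : ℂ) ^ 2 * ((b ∘ inclRight α β hα hβ G G' x x') ⬝ᵥ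
          (G'.Q x' *ᵥ star (c ∘ inclRight α β hα hβ G G' x x'))) := by
  classical
  -- For the left argument any extension will do, so its optimality is dropped.
  obtain ⟨f, rfl, -⟩ := (𝒫).exists_isOptimal (x, x') b
  obtain ⟨g₁, hb₁, hg₁⟩ := G.exists_isOptimal x (c ∘ inclLeft α β hα hβ G G' x x')
  obtain ⟨g₂, hb₂, hg₂⟩ := G'.exists_isOptimal x' (c ∘ inclRight α β hα hβ G G' x x')
  have hx : g₁ x = g₂ x' := funext fun i =>
    (congrFun hb₁ (.inl i)).trans (congrFun hb₂ (.inl i)).symm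
  -- At a corner `(y,y')` the equation `mixedDiff = 0` is solved for `g(y,y')`. The inverses stand
  -- in the order that undoes `σ_{xy} σ'_{x'y'}` directly. By `hx` the two slices agree where they
  -- meet.
  let g : V × V' → Fin d → ℂ := fun v =>
    if v.2 = x' then g₁ v.1 else if v.1 = x then g₂ v.2 else
      (((G'.conn x' v.2)⁻¹ : Matrix.unitaryGroup (Fin d) ℂ) : Matrix (Fin d) (Fin d) ℂ) *ᵥ
        (((G.conn x v.1)⁻¹ : Matrix.unitaryGroup (Fin d) ℂ) : Matrix (Fin d) (Fin d) ℂ) *ᵥ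
        ((G.conn x v.1 : Matrix (Fin d) (Fin d) ℂ) *ᵥ g₁ v.1
          + (G'.conn x' v.2 : Matrix (Fin d) (Fin d) ℂ) *ᵥ g₂ v.2 - g₁ x)
  have hgl : (fun v => g (v, x')) = g₁ := funext fun v => if_pos rfl
  have hgr : (fun v' => g (x, v')) = g₂ := by
    funext v'
    by_cases h : v' = x'
    · subst h
      simp [g, hx]
    · simp [g, h]
  have hgm : ∀ y ∈ G.nbrs x, ∀ y' ∈ G'.nbrs x', mixedDiff G G' x y x' y' g = 0 := by
    intro y hy y' hy'
    have e1 : g (y, x') = g₁ y := congrFun hgl y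
    have e2 : g (x, y') = g₂ y' := congrFun hgr y'
    have e3 : g (x, x') = g₁ x := congrFun hgl x
    rw [mixedDiff, e1, e2, e3]
    simp only [g, if_neg (ne_of_mem_nbrs hy).symm, if_neg (ne_of_mem_nbrs hy').symm]
    rw [conn_mulVec_inv, conn_mulVec_inv]
    abel
  have hopt : (𝒫).IsOptimal (x, x') g :=
    isOptimal_prod α β hα hβ hcomm (by rwa [hgl]) (by rwa [hgr]) hgm
  have hc : (𝒫).valB1 (x, x') g = c := by
    refine eq_of_comp_incl α β hα hβ G G' x x' ?_ ?_
    · rw [valB1_prod_inclLeft, hgl, hb₁]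
    · rw [valB1_prod_inclRight, hgr, hb₂]
  rw [← hc, valB1_dotProduct_Q _ _ hopt, prod_Gam2 α β hα hβ hcomm, valB1_prod_inclLeft,
    valB1_prod_inclRight, valB1_prod_inclLeft, valB1_prod_inclRight, hgl, hgr,
    G.valB1_dotProduct_Q _ hg₁, G'.valB1_dotProduct_Q _ hg₂,
    Finset.sum_eq_zero fun y hy => Finset.sum_eq_zero fun y' hy' => by
      rw [hgm y hy y' hy', star_zero, dotProduct_zero, mul_zero]]
  ring

/-! ### Rows of `B₀` on the product and the blocks `a`, `ωᵀ`, `C` -/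

theorem star_ofReal (r : ℝ) : star (r : ℂ) = r := Complex.conj_ofReal r

theorem BQB_apply (G : ConnectionGraph V d) (x : V)
    (B : Matrix (Fin d ⊕ (G.sphere x 1 × Fin d)) (Fin d ⊕ (G.sphere x 1 × Fin d)) ℂ)
    (u v : Fin d ⊕ (G.sphere x 1 × Fin d)) :
    G.BQB x B u v = 2 * (B u ⬝ᵥ (G.Q x *ᵥ star (B v))) := by
  rw [BQB, Matrix.smul_apply, smul_eq_mul, Matrix.mul_assoc]
  rfl

/-- Each entry of `2 B Q B̄ᵀ` is the form of `Q` at two rows of `B`. If these restrict to multiples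
of rows of `B₁` and `B₂`, the splitting of the form computes the entry. -/
theorem prod_BQB_apply
    (hcomm : ∀ g ∈ G.signatureGroup, ∀ g' ∈ G'.signatureGroup, g * g' = g' * g)
    (x : V) (x' : V')
    (B : Matrix (Fin d ⊕ ((𝒫).sphere (x, x') 1 × Fin d))
      (Fin d ⊕ ((𝒫).sphere (x, x') 1 × Fin d)) ℂ)
    (B₁ : Matrix (Fin d ⊕ (G.sphere x 1 × Fin d)) (Fin d ⊕ (G.sphere x 1 × Fin d)) ℂ)
    (B₂ : Matrix (Fin d ⊕ (G'.sphere x' 1 × Fin d)) (Fin d ⊕ (G'.sphere x' 1 × Fin d)) ℂ)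
    {u v : Fin d ⊕ ((𝒫).sphere (x, x') 1 × Fin d)}
    {u₁ v₁ : Fin d ⊕ (G.sphere x 1 × Fin d)} {u₂ v₂ : Fin d ⊕ (G'.sphere x' 1 × Fin d)}
    {r s r' s' : ℂ}
    (hu₁ : B u ∘ inclLeft α β hα hβ G G' x x' = r • B₁ u₁)
    (hv₁ : B v ∘ inclLeft α β hα hβ G G' x x' = s • B₁ v₁)
    (hu₂ : B u ∘ inclRight α β hα hβ G G' x x' = r' • B₂ u₂)
    (hv₂ : B v ∘ inclRight α β hα hβ G G' x x' = s' • B₂ v₂) :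
    (𝒫).BQB (x, x') B u v = (α : ℂ) ^ 2 * (r * star s) * G.BQB x B₁ u₁ v₁
      + (β : ℂ) ^ 2 * (r' * star s') * G'.BQB x' B₂ u₂ v₂ := by
  rw [BQB_apply, prod_Q_form α β hα hβ hcomm, hu₁, hv₁, hu₂, hv₂, BQB_apply, BQB_apply]
  simp only [star_smul, mulVec_smul, dotProduct_smul, smul_dotProduct, smul_eq_mul]
  ring

variable (G G')

theorem prod_B0_inl_left (x : V) (x' : V') (i : Fin d) :
    (𝒫).B0 (x, x') (.inl i) ∘ inclLeft α β hα hβ G G' x x' = G.B0 x (.inl i) := by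
  funext k
  rcases k with j | ⟨y, j⟩
  · rfl
  · change star (((𝒫).conn (x, x') (y, x') : Matrix (Fin d) (Fin d) ℂ) i j) = _
    rw [prod_conn_left]
    rfl

theorem ne_of_mem_sphere_one {G : ConnectionGraph V d} {x : V} (y : G.sphere x 1) :
    x ≠ y := ne_of_mem_nbrs (G.mem_nbrs.mpr (G.mem_sphere_one.mp y.2))

theorem prod_B0_inl_right (x : V) (x' : V') (i : Fin d) :
    (𝒫).B0 (x, x') (.inl i) ∘ inclRight α β hα hβ G G' x x' = G'.B0 x' (.inl i) := by
  funext k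
  rcases k with j | ⟨y, j⟩
  · rfl
  · change star (((𝒫).conn (x, x') (x, y) : Matrix (Fin d) (Fin d) ℂ) i j) = _
    rw [prod_conn_right _ _ _ _ _ _ _ (ne_of_mem_sphere_one y)]
    rfl

theorem sqrt_inv_mul {a : ℝ} (ha : 0 < a) (b : ℝ) :
    ((1 / √(a * b) : ℝ) : ℂ) = ((1 / √a : ℝ) : ℂ) * ((1 / √b : ℝ) : ℂ) := by
  rw [Real.sqrt_mul ha.le, ← Complex.ofReal_mul, div_mul_div_comm, one_mul]

open Classical in
theorem B0_inr_inr (G : ConnectionGraph V d) (x : V) (q r : G.sphere x 1 × Fin d) :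
    G.B0 x (.inr q) (.inr r) = if q = r then ((1 / √(G.p x q.1) : ℝ) : ℂ) else 0 := by
  rw [B0, Matrix.fromBlocks_apply₂₂, Matrix.diagonal_apply]

theorem prod_B0_inr_inl_left (x : V) (x' : V') (q : G.sphere x 1 × Fin d) :
    (𝒫).B0 (x, x') (.inr (prodIndex α β hα hβ G G' x x' (.inl q))) ∘
      inclLeft α β hα hβ G G' x x' = ((1 / √α : ℝ) : ℂ) • G.B0 x (.inr q) := by
  classical
  funext k
  rcases k with j | r
  · exact (mul_zero _).symm
  · rw [Pi.smul_apply, smul_eq_mul, B0_inr_inr]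
    refine ((𝒫).B0_inr_inr (x, x') _ _).trans ?_
    by_cases h : q = r
    · subst h
      rw [if_pos rfl, if_pos rfl]
      change ((1 / √((𝒫).p (x, x') (q.1, x')) : ℝ) : ℂ) = _
      rw [prod_p_left, sqrt_inv_mul hα]
    · rw [if_neg h, if_neg, mul_zero]
      exact fun e => h (Sum.inl_injective ((prodIndex α β hα hβ G G' x x').injective e))

theorem prod_B0_inr_inr_right (x : V) (x' : V') (q : G'.sphere x' 1 × Fin d) :
    (𝒫).B0 (x, x') (.inr (prodIndex α β hα hβ G G' x x' (.inr q))) ∘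
      inclRight α β hα hβ G G' x x' = ((1 / √β : ℝ) : ℂ) • G'.B0 x' (.inr q) := by
  classical
  funext k
  rcases k with j | r
  · exact (mul_zero _).symm
  · rw [Pi.smul_apply, smul_eq_mul, B0_inr_inr]
    refine ((𝒫).B0_inr_inr (x, x') _ _).trans ?_
    by_cases h : q = r
    · subst h
      rw [if_pos rfl, if_pos rfl]
      change ((1 / √((𝒫).p (x, x') (x, q.1)) : ℝ) : ℂ) = _
      rw [prod_p_right _ _ _ _ _ _ _ (ne_of_mem_sphere_one q.1), sqrt_inv_mul hβ]
    · rw [if_neg h, if_neg, mul_zero]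
      exact fun e => h (Sum.inr_injective ((prodIndex α β hα hβ G G' x x').injective e))

/-- The restriction is zero. It is written as `0` times an arbitrary row so that `prod_BQB_apply`
fits. -/
theorem prod_B0_inr_inr_left (x : V) (x' : V') (q : G'.sphere x' 1 × Fin d) (i : Fin d) :
    (𝒫).B0 (x, x') (.inr (prodIndex α β hα hβ G G' x x' (.inr q))) ∘
      inclLeft α β hα hβ G G' x x' = (0 : ℂ) • G.B0 x (.inl i) := by
  classical
  rw [zero_smul]
  funext k
  rcases k with j | r
  · rfl
  · refine ((𝒫).B0_inr_inr (x, x') _ _).trans (if_neg ?_)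
    exact fun e => Sum.inr_ne_inl ((prodIndex α β hα hβ G G' x x').injective e)

theorem prod_B0_inr_inl_right (x : V) (x' : V') (q : G.sphere x 1 × Fin d) (i : Fin d) :
    (𝒫).B0 (x, x') (.inr (prodIndex α β hα hβ G G' x x' (.inl q))) ∘
      inclRight α β hα hβ G G' x x' = (0 : ℂ) • G'.B0 x' (.inl i) := by
  classical
  rw [zero_smul]
  funext k
  rcases k with j | r
  · rfl
  · refine ((𝒫).B0_inr_inr (x, x') _ _).trans (if_neg ?_)
    exact fun e => Sum.inl_ne_inr ((prodIndex α β hα hβ G G' x x').injective e)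

variable {G G'}

theorem prod_a (hcomm : ∀ g ∈ G.signatureGroup, ∀ g' ∈ G'.signatureGroup, g * g' = g' * g)
    (x : V) (x' : V') :
    (𝒫).a (x, x') ((𝒫).B0 (x, x'))
      = ((α ^ 2 : ℝ) : ℂ) • G.a x (G.B0 x) + ((β ^ 2 : ℝ) : ℂ) • G'.a x' (G'.B0 x') := by
  ext i j
  have h := prod_BQB_apply α β hα hβ hcomm x x' ((𝒫).B0 (x, x')) (G.B0 x) (G'.B0 x')
    (u := .inl i) (v := .inl j) (u₁ := .inl i) (v₁ := .inl j) (u₂ := .inl i) (v₂ := .inl j)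
    (r := 1) (s := 1) (r' := 1) (s' := 1)
    (by rw [prod_B0_inl_left, one_smul]) (by rw [prod_B0_inl_left, one_smul])
    (by rw [prod_B0_inl_right, one_smul]) (by rw [prod_B0_inl_right, one_smul])
  refine h.trans ?_
  simp [a, Matrix.toBlocks₁₁]

theorem sq_mul_inv_sqrt {a : ℝ} (ha : 0 < a) :
    (a : ℂ) ^ 2 * ((1 / √a : ℝ) : ℂ) = ((a ^ (3 / 2 : ℝ) : ℝ) : ℂ) := by
  norm_cast
  rw [Real.sqrt_eq_rpow, one_div, ← Real.rpow_neg ha.le, ← Real.rpow_natCast, ← Real.rpow_add ha]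
  norm_num

theorem sq_mul_inv_sqrt_mul_self {a : ℝ} (ha : 0 < a) :
    (a : ℂ) ^ 2 * (((1 / √a : ℝ) : ℂ) * ((1 / √a : ℝ) : ℂ)) = (a : ℂ) := by
  norm_cast
  have h := Real.mul_self_sqrt ha.le
  have h' : √a ≠ 0 := (Real.sqrt_pos.mpr ha).ne'
  rw [div_mul_div_comm, h]
  field_simp

/-- The exponent `3/2` combines `α²` from the form with `α^{-1/2}` from the lower row of `B₀`. -/
theorem prod_omegaT
    (hcomm : ∀ g ∈ G.signatureGroup, ∀ g' ∈ G'.signatureGroup, g * g' = g' * g)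
    (x : V) (x' : V') :
    ((𝒫).omegaT (x, x') ((𝒫).B0 (x, x'))).submatrix id (prodIndex α β hα hβ G G' x x')
      = Matrix.fromCols (((α ^ (3 / 2 : ℝ) : ℝ) : ℂ) • G.omegaT x (G.B0 x))
          (((β ^ (3 / 2 : ℝ) : ℝ) : ℂ) • G'.omegaT x' (G'.B0 x')) := by
  ext i q
  rcases q with q | q
  · have h := prod_BQB_apply α β hα hβ hcomm x x' ((𝒫).B0 (x, x')) (G.B0 x) (G'.B0 x')
      (u := .inl i) (u₁ := .inl i) (u₂ := .inl i) (r := 1) (r' := 1)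
      (by rw [prod_B0_inl_left, one_smul]) (prod_B0_inr_inl_left α β hα hβ G G' x x' q)
      (by rw [prod_B0_inl_right, one_smul]) (prod_B0_inr_inl_right α β hα hβ G G' x x' q i)
    refine h.trans ?_
    rw [star_ofReal, one_mul, sq_mul_inv_sqrt hα, star_zero, mul_zero,
      mul_zero, zero_mul, add_zero]
    rfl
  · have h := prod_BQB_apply α β hα hβ hcomm x x' ((𝒫).B0 (x, x')) (G.B0 x) (G'.B0 x')
      (u := .inl i) (u₁ := .inl i) (u₂ := .inl i) (r := 1) (r' := 1)
      (by rw [prod_B0_inl_left, one_smul]) (prod_B0_inr_inr_left α β hα hβ G G' x x' q i)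
      (by rw [prod_B0_inl_right, one_smul]) (prod_B0_inr_inr_right α β hα hβ G G' x x' q)
    refine h.trans ?_
    rw [star_ofReal, one_mul, one_mul, sq_mul_inv_sqrt hβ, star_zero, mul_zero, zero_mul,
      zero_add]
    rfl

/-- Lower rows of `B₀` belonging to different factors never meet in either summand of the form.
Within one factor the scalar is `α² · α^{-1} = α`. -/
theorem prod_BQB_toBlocks₂₂
    (hcomm : ∀ g ∈ G.signatureGroup, ∀ g' ∈ G'.signatureGroup, g * g' = g' * g)
    (x : V) (x' : V') :
    ((𝒫).BQB (x, x') ((𝒫).B0 (x, x'))).toBlocks₂₂.submatrix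
        (prodIndex α β hα hβ G G' x x') (prodIndex α β hα hβ G G' x x')
      = Matrix.fromBlocks ((α : ℂ) • (G.BQB x (G.B0 x)).toBlocks₂₂) 0
          0 ((β : ℂ) • (G'.BQB x' (G'.B0 x')).toBlocks₂₂) := by
  have key := @prod_BQB_apply V V' d α β hα hβ G G' hcomm x x' ((𝒫).B0 (x, x')) (G.B0 x)
    (G'.B0 x')
  ext q r
  rcases q with q | q <;> rcases r with r | r
  -- Here `q.2` merely supplies an element of `Fin d` as the dummy index of the zero rows.
  · refine (key (prod_B0_inr_inl_left α β hα hβ G G' x x' q)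
      (prod_B0_inr_inl_left α β hα hβ G G' x x' r)
      (prod_B0_inr_inl_right α β hα hβ G G' x x' q q.2)
      (prod_B0_inr_inl_right α β hα hβ G G' x x' r q.2)).trans ?_
    rw [star_ofReal, sq_mul_inv_sqrt_mul_self hα, zero_mul,
      mul_zero, zero_mul, add_zero]
    rfl
  · refine (key (prod_B0_inr_inl_left α β hα hβ G G' x x' q)
      (prod_B0_inr_inr_left α β hα hβ G G' x x' r q.2)
      (prod_B0_inr_inl_right α β hα hβ G G' x x' q q.2)
      (prod_B0_inr_inr_right α β hα hβ G G' x x' r)).trans ?_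
    rw [star_zero, mul_zero, zero_mul, mul_zero, mul_zero, zero_mul, zero_mul, add_zero]
    rfl
  · refine (key (prod_B0_inr_inr_left α β hα hβ G G' x x' q q.2)
      (prod_B0_inr_inl_left α β hα hβ G G' x x' r)
      (prod_B0_inr_inr_right α β hα hβ G G' x x' q)
      (prod_B0_inr_inl_right α β hα hβ G G' x x' r q.2)).trans ?_
    rw [star_zero, mul_zero, zero_mul, mul_zero, mul_zero, zero_mul, zero_mul, add_zero]
    rfl
  · refine (key (prod_B0_inr_inr_left α β hα hβ G G' x x' q q.2)
      (prod_B0_inr_inr_left α β hα hβ G G' x x' r q.2)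
      (prod_B0_inr_inr_right α β hα hβ G G' x x' q)
      (prod_B0_inr_inr_right α β hα hβ G G' x x' r)).trans ?_
    rw [star_ofReal, sq_mul_inv_sqrt_mul_self hβ, zero_mul,
      mul_zero, zero_mul, zero_add]
    rfl

variable (G G')

theorem v0_B0_apply (G : ConnectionGraph V d) (x : V) (q : G.sphere x 1 × Fin d) (j : Fin d) :
    G.v0 x (G.B0 x) q j
      = ((√(G.p x q.1) : ℝ) : ℂ) * (G.conn x q.1 : Matrix (Fin d) (Fin d) ℂ) j q.2 := by
  rw [v0, B0_mul_lapMatrix]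
  rfl

theorem prod_v0 (x : V) (x' : V') :
    ((𝒫).v0 (x, x') ((𝒫).B0 (x, x'))).submatrix (prodIndex α β hα hβ G G' x x') id
      = Matrix.fromRows (((√α : ℝ) : ℂ) • G.v0 x (G.B0 x))
          (((√β : ℝ) : ℂ) • G'.v0 x' (G'.B0 x')) := by
  ext q j
  rw [Matrix.submatrix_apply, v0_B0_apply]
  rcases q with q | q
  · change ((√((𝒫).p (x, x') (q.1, x')) : ℝ) : ℂ) *
      ((𝒫).conn (x, x') (q.1, x') : Matrix (Fin d) (Fin d) ℂ) j q.2
        = ((√α : ℝ) : ℂ) * G.v0 x (G.B0 x) q j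
    rw [prod_p_left, prod_conn_left, v0_B0_apply, Real.sqrt_mul hα.le, Complex.ofReal_mul,
      mul_assoc]
  · have h := ne_of_mem_sphere_one q.1
    change ((√((𝒫).p (x, x') (x, q.1)) : ℝ) : ℂ) *
      ((𝒫).conn (x, x') (x, q.1) : Matrix (Fin d) (Fin d) ℂ) j q.2
        = ((√β : ℝ) : ℂ) * G'.v0 x' (G'.B0 x') q j
    rw [prod_p_right _ _ _ _ _ _ _ h, prod_conn_right _ _ _ _ _ _ _ h, v0_B0_apply,
      Real.sqrt_mul hβ.le, Complex.ofReal_mul, mul_assoc]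

end Product

/-! ### Scaling of the pseudoinverse -/

theorem pinv_eq {m n : Type*} [Fintype m] [Fintype n] {M : Matrix m n ℂ} {X : Matrix n m ℂ}
    (h : IsMoorePenroseInverse M X) : pinv M = X := (pinv_spec M).unique h

theorem pinv_smul {m n : Type*} [Fintype m] [Fintype n] {c : ℂ} (hc : c ≠ 0)
    (M : Matrix m n ℂ) : pinv (c • M) = c⁻¹ • pinv M := by
  have h := pinv_spec M
  have e1 : (c • M) * (c⁻¹ • pinv M) = M * pinv M := by
    rw [Matrix.smul_mul, Matrix.mul_smul, smul_smul, mul_inv_cancel₀ hc, one_smul]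
  have e2 : (c⁻¹ • pinv M) * (c • M) = pinv M * M := by
    rw [Matrix.smul_mul, Matrix.mul_smul, smul_smul, inv_mul_cancel₀ hc, one_smul]
  refine pinv_eq ⟨?_, ?_, ?_, ?_⟩
  · rw [e1, Matrix.mul_smul, h.mul_mul_left]
  · rw [e2, Matrix.mul_smul, h.mul_mul_right]
  · rw [e1]; exact h.isHermitian_left
  · rw [e2]; exact h.isHermitian_right

/-! ### The coefficients of `J` -/

/-- The default values agree: `∞` has real part `0`, and real division by `0` gives the intended
`2/∞ = 0`. -/
theorem two_div_toReal (N : ℝ≥0∞) : (2 / N).toReal = 2 / N.toReal := by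
  rw [ENNReal.toReal_div, ENNReal.toReal_ofNat]

theorem jCoeff_nonneg (N N' : ℝ≥0∞) : 0 ≤ jCoeff N N' := by
  rw [jCoeff]
  split_ifs <;> positivity

/-- For finite arguments this is `2/N - 2/(N+N') = (2/(N+N')) (N'/N)`; the conventions at infinity
preserve it. -/
theorem jCoeff_sub {N N' : ℝ≥0∞} (hN : 0 < N) (hN' : 0 < N') :
    jCoeff N N' - (2 / N).toReal = -(2 / (N + N')).toReal := by
  rw [two_div_toReal, two_div_toReal, jCoeff]
  by_cases h : N = ⊤
  · simp [h]
  by_cases h' : N' = ⊤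
  · simp [h, h']
  have p := ENNReal.toReal_pos hN.ne' h
  have p' := ENNReal.toReal_pos hN'.ne' h'
  rw [if_neg h, if_neg h', ENNReal.toReal_add h h']
  field_simp
  ring

theorem jCoeff_mul {N N' : ℝ≥0∞} (hN : 0 < N) (hN' : 0 < N') :
    jCoeff N N' * jCoeff N' N = (2 / (N + N')).toReal ^ 2 := by
  rw [two_div_toReal, jCoeff, jCoeff]
  by_cases h : N = ⊤
  · simp [h]
  by_cases h' : N' = ⊤
  · simp [h']
  have p := ENNReal.toReal_pos hN.ne' h
  have p' := ENNReal.toReal_pos hN'.ne' h'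
  rw [if_neg h, if_neg h', if_neg h, if_neg h', ENNReal.toReal_add h h']
  field_simp
  ring

/-- Taking square roots of the diagonal coefficients, `jCoeff_mul` makes their product the
off-diagonal coefficient, so that `J` is a Gram matrix `u uᴴ`, the sign being carried by the second
block of `u`. -/
theorem J_posSemidef {α β : ℝ} (hα : 0 < α) (hβ : 0 < β) (G : ConnectionGraph V d)
    (G' : ConnectionGraph V' d) (x : V) (x' : V') {N N' : ℝ≥0∞} (hN : 0 < N) (hN' : 0 < N') :
    (J α β N N' G G' x x').PosSemidef := by
  have hr := mul_nonneg hα.le (jCoeff_nonneg N N')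
  have hs := mul_nonneg hβ.le (jCoeff_nonneg N' N)
  set r := √(α * jCoeff N N') with r_def
  set s := √(β * jCoeff N' N) with s_def
  have e1 : α * jCoeff N N' = r * r := (Real.mul_self_sqrt hr).symm
  have e2 : β * jCoeff N' N = s * s := (Real.mul_self_sqrt hs).symm
  have e3 : (2 / (N + N')).toReal * √(α * β) = r * s := by
    rw [r_def, s_def, ← Real.sqrt_mul hr, mul_mul_mul_comm, jCoeff_mul hN hN',
      Real.sqrt_mul (mul_pos hα hβ).le, Real.sqrt_sq ENNReal.toReal_nonneg, mul_comm]
  have hu : J α β N N' G G' x x'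
      = Matrix.fromRows ((r : ℂ) • G.v0 x (G.B0 x)) (-((s : ℂ) • G'.v0 x' (G'.B0 x')))
        * (Matrix.fromRows ((r : ℂ) • G.v0 x (G.B0 x)) (-((s : ℂ) • G'.v0 x' (G'.B0 x'))))ᴴ := by
    rw [Matrix.conjTranspose_fromRows_eq_fromCols_conjTranspose, Matrix.fromRows_mul_fromCols,
      J, e1, e2, e3]
    simp only [Matrix.conjTranspose_neg, Matrix.conjTranspose_smul, star_ofReal,
      Matrix.mul_neg, Matrix.neg_mul, Matrix.smul_mul, Matrix.mul_smul, smul_smul, smul_neg,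
      neg_neg, Complex.ofReal_mul, mul_comm (s : ℂ) (r : ℂ)]
  rw [hu]
  exact Matrix.posSemidef_self_mul_conjTranspose _

/-! ### The curvature matrix of a Cartesian product -/

section Product

variable {α β : ℝ} (hα : 0 < α) (hβ : 0 < β) {G : ConnectionGraph V d}
  {G' : ConnectionGraph V' d}

local notation "𝒫" => ConnectionGraph.prod α β hα hβ G G'

/-- Subtracting `ω̄ a† ωᵀ` on the product uses `(α²a + β²a')†` in every block, whereas the factors
use their own pseudoinverses. `R` is precisely this discrepancy, and no formula for the
pseudoinverse of a sum is needed. -/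
theorem prod_AInf
    (hcomm : ∀ g ∈ G.signatureGroup, ∀ g' ∈ G'.signatureGroup, g * g' = g' * g)
    (x : V) (x' : V') :
    ((𝒫).AInf (x, x') ((𝒫).B0 (x, x'))).submatrix (prodIndex α β hα hβ G G' x x')
        (prodIndex α β hα hβ G G' x x')
      = Matrix.fromBlocks ((α : ℂ) • G.AInf x (G.B0 x)) 0 0 ((β : ℂ) • G'.AInf x' (G'.B0 x'))
        + R α β G G' x x' := by
  have h3 : ∀ {t : ℝ}, 0 < t → ((t ^ (3 / 2 : ℝ) : ℝ) : ℂ) * ((t ^ (3 / 2 : ℝ) : ℝ) : ℂ)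
      = ((t ^ 3 : ℝ) : ℂ) := fun {t} ht => by
    rw [← Complex.ofReal_mul, ← Real.rpow_add ht]
    norm_num
  -- Reconciles `α³ (α²a)†` in `R` with `α a†` in `α A_∞`.
  have h4 : ∀ {t : ℝ}, 0 < t → ((t ^ 3 : ℝ) : ℂ) * ((t ^ 2 : ℝ) : ℂ)⁻¹ = t := fun {t} ht => by
    rw [← Complex.ofReal_inv, ← Complex.ofReal_mul]
    congr 1
    field_simp
  have hα2 : ((α ^ 2 : ℝ) : ℂ) ≠ 0 := Complex.ofReal_ne_zero.mpr (pow_pos hα 2).ne'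
  have hβ2 : ((β ^ 2 : ℝ) : ℂ) ≠ 0 := Complex.ofReal_ne_zero.mpr (pow_pos hβ 2).ne'
  set e := prodIndex α β hα hβ G G' x x'
  have hω := prod_omegaT α β hα hβ hcomm x x'
  -- Reindexing touches only the outer indices; the summation runs over `Fin d`, so this holds by
  -- definition.
  have hsub : (((𝒫).omegaT (x, x') ((𝒫).B0 (x, x')))ᴴ *
        pinv ((𝒫).a (x, x') ((𝒫).B0 (x, x'))) *
        (𝒫).omegaT (x, x') ((𝒫).B0 (x, x'))).submatrix e e
      = (((𝒫).omegaT (x, x') ((𝒫).B0 (x, x'))).submatrix id e)ᴴ *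
        pinv ((𝒫).a (x, x') ((𝒫).B0 (x, x'))) *
        ((𝒫).omegaT (x, x') ((𝒫).B0 (x, x'))).submatrix id e := rfl
  rw [AInf, Matrix.submatrix_sub, Pi.sub_apply, Pi.sub_apply, hsub, hω,
    prod_BQB_toBlocks₂₂ α β hα hβ hcomm, prod_a α β hα hβ hcomm,
    Matrix.conjTranspose_fromCols_eq_fromRows_conjTranspose, Matrix.fromRows_mul,
    Matrix.fromRows_mul_fromCols, R, AInf, AInf]
  simp only [pinv_smul hα2, pinv_smul hβ2, Matrix.conjTranspose_smul, star_ofReal,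
    Matrix.smul_mul, Matrix.mul_smul, smul_smul, h3 hα, h3 hβ, Matrix.mul_sub, Matrix.sub_mul,
    smul_sub, h4 hα, h4 hβ, Complex.ofReal_mul, mul_comm ((β ^ (3 / 2 : ℝ) : ℝ) : ℂ)]
  rw [sub_eq_add_neg, Matrix.fromBlocks_neg, Matrix.fromBlocks_add, Matrix.fromBlocks_add]
  congr 1 <;> abel

theorem prod_A
    (hcomm : ∀ g ∈ G.signatureGroup, ∀ g' ∈ G'.signatureGroup, g * g' = g' * g)
    (x : V) (x' : V') {N N' : ℝ≥0∞} (hN : 0 < N) (hN' : 0 < N') :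
    ((𝒫).A (N + N') (x, x') ((𝒫).B0 (x, x'))).submatrix (prodIndex α β hα hβ G G' x x')
        (prodIndex α β hα hβ G G' x x')
      = Matrix.fromBlocks ((α : ℂ) • G.A N x (G.B0 x)) 0 0 ((β : ℂ) • G'.A N' x' (G'.B0 x'))
        + R α β G G' x x' + J α β N N' G G' x x' := by
  set e := prodIndex α β hα hβ G G' x x'
  set c := (2 / (N + N')).toReal with hc
  have hsub : ((c : ℂ) • ((𝒫).v0 (x, x') ((𝒫).B0 (x, x')) *
        ((𝒫).v0 (x, x') ((𝒫).B0 (x, x')))ᴴ)).submatrix e e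
      = (c : ℂ) • (((𝒫).v0 (x, x') ((𝒫).B0 (x, x'))).submatrix e id *
        (((𝒫).v0 (x, x') ((𝒫).B0 (x, x'))).submatrix e id)ᴴ) := rfl
  -- `J` replaces the separate corrections `2/N` and `2/N'` of the factors by the single correction
  -- `2/(N+N')` for the stacked matrix `v₀` of the product.
  have hJ : Matrix.fromBlocks ((α : ℂ) • G.A N x (G.B0 x)) 0 0
        ((β : ℂ) • G'.A N' x' (G'.B0 x')) + J α β N N' G G' x x'
      = Matrix.fromBlocks ((α : ℂ) • G.AInf x (G.B0 x)) 0 0 ((β : ℂ) • G'.AInf x' (G'.B0 x'))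
        - (c : ℂ) • (Matrix.fromRows (((√α : ℝ) : ℂ) • G.v0 x (G.B0 x))
          (((√β : ℝ) : ℂ) • G'.v0 x' (G'.B0 x')) *
          (Matrix.fromRows (((√α : ℝ) : ℂ) • G.v0 x (G.B0 x))
          (((√β : ℝ) : ℂ) • G'.v0 x' (G'.B0 x')))ᴴ) := by
    have k1 : ((α * jCoeff N N' : ℝ) : ℂ) = α * ((2 / N).toReal : ℂ) - c * α := by
      have := jCoeff_sub hN hN'
      rw [← hc, sub_eq_iff_eq_add] at this
      rw [this]
      push_cast
      ring
    have k2 : ((β * jCoeff N' N : ℝ) : ℂ) = β * ((2 / N').toReal : ℂ) - c * β := by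
      have := jCoeff_sub hN' hN
      rw [add_comm N' N, ← hc, sub_eq_iff_eq_add] at this
      rw [this]
      push_cast
      ring
    have hs : ∀ {t : ℝ}, 0 < t → ((√t : ℝ) : ℂ) * ((√t : ℝ) : ℂ) = t := fun {t} ht => by
      rw [← Complex.ofReal_mul, Real.mul_self_sqrt ht.le]
    have hm : ((c * √(α * β) : ℝ) : ℂ) = c * (((√α : ℝ) : ℂ) * ((√β : ℝ) : ℂ)) := by
      rw [Real.sqrt_mul hα.le]
      push_cast
      ring
    rw [J, k1, k2, ← hc, hm, A, A, Matrix.conjTranspose_fromRows_eq_fromCols_conjTranspose,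
      Matrix.fromRows_mul_fromCols]
    simp only [Matrix.conjTranspose_smul, star_ofReal, Matrix.smul_mul, Matrix.mul_smul, smul_smul,
      hs hα, hs hβ, smul_sub, sub_smul, Matrix.fromBlocks_smul, mul_comm ((√β : ℝ) : ℂ)]
    simp only [sub_eq_add_neg, Matrix.fromBlocks_neg, Matrix.fromBlocks_add]
    congr 1 <;> abel
  rw [add_right_comm, hJ, A, Matrix.submatrix_sub, Pi.sub_apply, Pi.sub_apply, hsub,
    prod_v0, prod_AInf hα hβ hcomm]
  abel

end Product

end ConnectionGraph

end

theorem mainTheorem7 {V V' : Type*} {d : ℕ}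
    (G : ConnectionGraph V d) (G' : ConnectionGraph V' d)
    (α β : ℝ) (hα : 0 < α) (hβ : 0 < β)
    (hcomm : ∀ g ∈ G.signatureGroup, ∀ g' ∈ G'.signatureGroup, g * g' = g' * g)
    (x : V) (x' : V') (N N' : ℝ≥0∞) (hN : 0 < N) (hN' : 0 < N') :
    ((ConnectionGraph.prod α β hα hβ G G').A (N + N') (x, x')
        ((ConnectionGraph.prod α β hα hβ G G').B0 (x, x'))).submatrix
        (ConnectionGraph.prodIndex α β hα hβ G G' x x')
        (ConnectionGraph.prodIndex α β hα hβ G G' x x')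
      = Matrix.fromBlocks
          ((α : ℂ) • G.A N x (G.B0 x)) 0
          0 ((β : ℂ) • G'.A N' x' (G'.B0 x'))
        + ConnectionGraph.R α β G G' x x'
        + ConnectionGraph.J α β N N' G G' x x'
    ∧ (ConnectionGraph.J α β N N' G G' x x').PosSemidef :=
  ⟨ConnectionGraph.prod_A hα hβ hcomm x x' hN hN',
    ConnectionGraph.J_posSemidef hα hβ G G' x x' hN hN'⟩
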